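/- Let $N\ge 1$ be an integer, $0<\lambda<1$, and let $T\ge 0$ be a real threshold. Consider $N$ queues, namely the uplinks of the first layer of a fat-tree network. Packets arrive in a Poisson process of rate $N\lambda$. Each arriving packet has a default uplink $h$, uniformly distributed on the $N$ uplinks, and an alternative uplink $r$ which, given $h$, is uniformly distributed on a nonempty set $A(h)$ of uplinks (for instance all uplinks, all uplinks other than $h$, or the other uplinks of the switch to which $h$ belongs). If $Q_i$ denotes the number of packets at uplink $i$, the packet joins $r$ if $Q_r<Q_h-T$, and joins $h$ otherwise (threshold-based two-choice). Each uplink serves its packets one at a time, with independent exponential service times of parameter $1$. The queue-length vector $\mathbf Q(t)=(Q_1(t),\dots,Q_N(t))$ is then a continuous-time Markov chain on $\{0,1,2,\dots\}^N$. Its transition rates are $q\mapsto q+e_i$ at rate $N\lambda\,p_i(q)$, where $p_i(q)$ is the probability that a packet arriving in state $q$ joins uplink $i$, and $q\mapsto q-e_i$ at rate $1$ if $q_i>0$. **Theorem 2.** The chain $(\mathbf Q(t))$ is irreducible, nonexplosive and positive recurrent. It has exactly one equilibrium (stationary) distribution, and for the chain started from this distribution, $$E\Big[\frac1N\sum_{i=1}^N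 Q_i(t)\Big]<\frac1{1-\lambda}\qquad\text{for all } t\ge 0 ,$$ whatever the values of $N$, $T$ and the sets $A(h)$. -/

import Mathlib

open MeasureTheory ProbabilityTheory
open scoped NNReal ENNReal

noncomputable section

/-- The exponential law with parameter `1` is a probability measure. -/
instance instIsProbabilityMeasureExpOne : IsProbabilityMeasure (expMeasure 1) :=
  isProbabilityMeasure_expMeasure one_pos

/-- The off-diagonal part of a (stable, conservative) transition rate matrix on `S`:
`rate x y` is the rate of jumps from `x` to `y ≠ x`, and the total rate out of every state is
finite. -/
structure RateMatrix (S : Type*) where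
  rate : S → S → ℝ≥0
  rate_self : ∀ x, rate x x = 0
  summable_rate : ∀ x, Summable (rate x)

namespace RateMatrix

variable {S : Type*}

/-- Total rate out of the state `x`. -/
def exitRate (Q : RateMatrix S) (x : S) : ℝ≥0 := ∑' y, Q.rate x y

theorem tsum_rate_eq (Q : RateMatrix S) (x : S) :
    (∑' y, (Q.rate x y : ℝ≥0∞)) = (Q.exitRate x : ℝ≥0∞) :=
  (ENNReal.coe_tsum (Q.summable_rate x)).symm

open Classical in
/-- Law of the next state visited after `x`: proportional to the rates out of `x`. A state with
exit rate `0` is absorbing. -/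
def jumpPMF (Q : RateMatrix S) (x : S) : PMF S :=
  if h : Q.exitRate x = 0 then PMF.pure x
  else PMF.normalize (fun y => (Q.rate x y : ℝ≥0∞))
    (by rw [Q.tsum_rate_eq]; exact_mod_cast h)
    (by rw [Q.tsum_rate_eq]; exact ENNReal.coe_ne_top)

variable [Countable S] [MeasurableSpace S] [DiscreteMeasurableSpace S]

/-- Transition kernel of the jump chain. -/
def jumpKernel (Q : RateMatrix S) : Kernel S S where
  toFun x := (Q.jumpPMF x).toMeasure
  measurable' := Measurable.of_discrete

instance (Q : RateMatrix S) : IsMarkovKernel Q.jumpKernel :=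
  ⟨fun x => PMF.toMeasure.isProbabilityMeasure (Q.jumpPMF x)⟩

/-- Transition kernel of the jump chain as a function of the whole past: only the present state
matters. -/
def pastKernel (Q : RateMatrix S) (n : ℕ) : Kernel ((i : Finset.Iic n) → S) S :=
  Q.jumpKernel.comap (fun past => past ⟨n, Finset.mem_Iic.2 le_rfl⟩) (measurable_pi_apply _)

instance (Q : RateMatrix S) (n : ℕ) : IsMarkovKernel (Q.pastKernel n) := by
  unfold pastKernel; infer_instance

/-- Sample space of the jump chain/holding time construction: the sequence of visited states and
a sequence of standard exponential clocks. -/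
abbrev Path (S : Type*) : Type _ := (ℕ → S) × (ℕ → ℝ)

/-- Law, on the sample space, of the continuous-time Markov chain with rates `Q` and initial
distribution `μ`: the visited states form the discrete-time Markov chain with initial
distribution `μ` and kernel `jumpKernel`, and the clocks are i.i.d. exponential with parameter `1`
and independent of the visited states. -/
def law (Q : RateMatrix S) (μ : Measure S) [IsProbabilityMeasure μ] : Measure (Path S) :=
  (Kernel.trajMeasure (X := fun _ => S) μ Q.pastKernel).prod
    (Measure.infinitePi fun _ : ℕ => expMeasure 1)

/-- Law of the chain started from the state `x`. -/
def lawFrom (Q : RateMatrix S) (x : S) : Measure (Path S) := Q.law (Measure.dirac x)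

/-- Holding time in the `n`-th visited state `x`: exponential with parameter the exit rate of `x`
(infinite if `x` is absorbing). -/
def holding (Q : RateMatrix S) (n : ℕ) (ω : Path S) : ℝ≥0∞ :=
  ENNReal.ofReal (ω.2 n) / (Q.exitRate (ω.1 n) : ℝ≥0∞)

/-- Time of the `n`-th jump (`jumpTime 0 = 0`). -/
def jumpTime (Q : RateMatrix S) (n : ℕ) (ω : Path S) : ℝ≥0∞ :=
  ∑ k ∈ Finset.range n, Q.holding k ω

open Classical in
/-- State of the chain at time `t`: the `n`-th visited state if
`jumpTime n ≤ t < jumpTime (n + 1)`, and `none` if the chain has exploded by time `t`. -/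
def state (Q : RateMatrix S) (t : ℝ≥0) (ω : Path S) : Option S :=
  if h : ∃ n, (t : ℝ≥0∞) < Q.jumpTime (n + 1) ω then some (ω.1 (Nat.find h)) else none

/-- First time, after the first jump, at which the chain is in the state `x`. -/
def returnTime (Q : RateMatrix S) (x : S) (ω : Path S) : ℝ≥0∞ :=
  ⨅ (t : ℝ≥0) (_ : Q.jumpTime 1 ω ≤ t) (_ : Q.state t ω = some x), (t : ℝ≥0∞)

/-- Every state can be reached from every state with positive probability. -/
def IsIrreducible (Q : RateMatrix S) : Prop :=
  ∀ x y, ∃ t : ℝ≥0, 0 < Q.lawFrom x {ω | Q.state t ω = some y}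

/-- From every initial state, almost surely there are only finitely many jumps in finite time. -/
def IsNonexplosive (Q : RateMatrix S) : Prop :=
  ∀ x, ∀ᵐ ω ∂(Q.lawFrom x), ∑' n, Q.holding n ω = ∞

/-- Every state is absorbing or has a finite expected return time. -/
def IsPositiveRecurrent (Q : RateMatrix S) : Prop :=
  ∀ x, Q.exitRate x = 0 ∨ ∫⁻ ω, Q.returnTime x ω ∂(Q.lawFrom x) < ∞

/-- `π` is an equilibrium distribution: started from `π`, the chain has the distribution `π` at
all times. -/
def IsEquilibrium (Q : RateMatrix S) (π : ProbabilityMeasure S) : Prop :=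
  ∀ (t : ℝ≥0) (y : S), Q.law (π : Measure S) {ω | Q.state t ω = some y} = (π : Measure S) {y}

end RateMatrix

namespace TTC

variable {N : ℕ}

/-- Uplink joined by a packet with default uplink `h` and random alternative `r` when the queue
lengths are `q`: the packet is redirected to `r` if and only if `q r < q h - T`. -/
def route (T : ℝ) (q : Fin N → ℕ) (h r : Fin N) : Fin N :=
  if (q r : ℝ) < (q h : ℝ) - T then r else h

/-- Probability that an arriving packet joins uplink `i` when the queue lengths are `q`: the
default uplink `h` is uniform on all `N` uplinks and, given `h`, the alternative is uniform on the
set `A h` of alternatives of `h`. -/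
def joinProb (T : ℝ) (A : Fin N → Finset (Fin N)) (q : Fin N → ℕ) (i : Fin N) : ℝ≥0 :=
  ∑ h, (N : ℝ≥0)⁻¹ * ∑ r ∈ A h, ((A h).card : ℝ≥0)⁻¹ * if route T q h r = i then 1 else 0

/-- Transition rates of the vector of queue lengths: from `q`, packets join uplink `i` at rate
`N * lam` times the probability of joining `i`, and leave each nonempty queue at rate `1`. -/
def rate (lam : ℝ≥0) (T : ℝ) (A : Fin N → Finset (Fin N)) (q q' : Fin N → ℕ) : ℝ≥0 :=
  (∑ i, if q' = Function.update q i (q i + 1) then N * lam * joinProb T A q i else 0) +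
    ∑ i, if 0 < q i ∧ q' = Function.update q i (q i - 1) then 1 else 0

theorem rate_self (lam : ℝ≥0) (T : ℝ) (A : Fin N → Finset (Fin N)) (q : Fin N → ℕ) :
    rate lam T A q q = 0 := by
  have h1 : ∀ i, q ≠ Function.update q i (q i + 1) := fun i h => by
    have := congrFun h i
    simp at this
  have h2 : ∀ i, ¬ (0 < q i ∧ q = Function.update q i (q i - 1)) := fun i h => by
    have h3 := congrFun h.2 i
    rw [Function.update_self] at h3
    have h4 := h.1
    omega
  simp only [rate, h1, h2, if_false, Finset.sum_const_zero, add_zero]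

theorem summable_rate (lam : ℝ≥0) (T : ℝ) (A : Fin N → Finset (Fin N)) (q : Fin N → ℕ) :
    Summable (rate lam T A q) := by
  refine Summable.add (summable_sum fun i _ => ?_) (summable_sum fun i _ => ?_)
  · refine summable_of_ne_finset_zero (s := {Function.update q i (q i + 1)}) fun b hb => ?_
    rw [if_neg (by simpa using hb)]
  · refine summable_of_ne_finset_zero (s := {Function.update q i (q i - 1)}) fun b hb => ?_
    rw [if_neg (fun h => hb (by simpa using h.2))]

/-- The continuous-time Markov chain of the queue lengths of `N` uplinks under threshold-based
two-choice with threshold `T`. -/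
def chain (N : ℕ) (lam : ℝ≥0) (T : ℝ) (A : Fin N → Finset (Fin N)) : RateMatrix (Fin N → ℕ) where
  rate := rate lam T A
  rate_self := rate_self lam T A
  summable_rate := summable_rate lam T A

/-- Average queue length (infinite for an exploded chain). -/
def averageQueue : Option (Fin N → ℕ) → ℝ≥0∞
  | none => ∞
  | some q => (∑ i, (q i : ℝ≥0∞)) / N

end TTC

end

/-!
Routing a packet to `r` instead of `h` only when `q r < q h - T` never increases the length of the
queue that it joins, so the energy `∑ i, q i ^ 2` drifts under two-choice as it does for independent
queues: `∑ y, rate q y * (energy y - energy q) ≤ N * (1 + λ) - 2 * (1 - λ) * ∑ i, q i`.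

The exit rates are bounded, so the chain does not explode, and in its uniformization, a
discrete-time chain, the drift keeps the Cesàro averages of the distributions tight. A limit of
these averages is an invariant distribution, under which the average queue length has mean at most
`(1 + λ) / (2 * (1 - λ)) < 1 / (1 - λ)`. It solves the balance equations of the rates and is an
equilibrium by Kolmogorov's backward equation. All transition probabilities being positive, the
pointwise minimum of two equilibria is again invariant, which makes them equal. Finally, when the
jump chain has the invariant measure `m`, the expected reward collected before the return to `x` is
at most `1 / m x` times the integral of the reward against `m`; applied to the mean holding times,
this bounds the expected return times.
-/

noncomputable section

/-! ### Discrete-time Markov chains -/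

section Sequences

variable {α : Type*}

/-- The sequence `a, u 0, u 1, …`. It describes a path by its first step and the path after this
step. -/
def seqCons (a : α) (u : ℕ → α) : ℕ → α
  | 0 => a
  | n + 1 => u n

theorem seqCons_succ (a : α) (u : ℕ → α) (n : ℕ) : seqCons a u (n + 1) = u n := rfl

theorem seqCons_preimage_cylinder_succ (x : α) (a : ℕ → α) (n : ℕ) :
    seqCons x ⁻¹' PiNat.cylinder a (n + 1) =
      {u | x = a 0 ∧ u ∈ PiNat.cylinder (fun i => a (i + 1)) n} := by
  ext u
  simp only [Set.mem_preimage, PiNat.mem_cylinder_iff, Set.mem_ofPred_eq]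
  rw [Nat.forall_lt_succ_left']
  rfl

theorem frestrictLe_preimage_singleton (a : ℕ → α) (n : ℕ) :
    Preorder.frestrictLe (π := fun _ => α) n ⁻¹' {Preorder.frestrictLe n a} =
      PiNat.cylinder a (n + 1) := by
  ext u
  simp only [Set.mem_preimage, Set.mem_singleton_iff, funext_iff, Subtype.forall, Finset.mem_Iic,
    Preorder.frestrictLe_apply, PiNat.mem_cylinder_iff, Nat.lt_succ_iff]

theorem measurable_seqCons [MeasurableSpace α] :
    Measurable fun p : α × (ℕ → α) => seqCons p.1 p.2 := by
  refine measurable_pi_lambda _ fun n => ?_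
  cases n with
  | zero => exact measurable_fst
  | succ n => exact (measurable_pi_apply n).comp measurable_snd

theorem measurable_seqCons_right [MeasurableSpace α] (a : α) : Measurable (seqCons a) :=
  measurable_seqCons.comp measurable_prodMk_left

theorem infinitePi_eq_map_seqCons [MeasurableSpace α] (ν : Measure α) [IsProbabilityMeasure ν] :
    (Measure.infinitePi fun _ : ℕ => ν) =
      (ν.prod (Measure.infinitePi fun _ : ℕ => ν)).map (fun p => seqCons p.1 p.2) := by
  classical
  refine (Measure.eq_infinitePi _ fun s t ht => ?_).symm
  let t' : ℕ → Set α := fun i => if i ∈ s then t i else Set.univ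
  have ht' : ∀ i, MeasurableSet (t' i) := fun i => by
    dsimp only [t']; split_ifs; exacts [ht i, .univ]
  obtain ⟨n, hn⟩ : ∃ n, s ⊆ Finset.range (n + 1) :=
    ⟨s.sup id, fun i hi => Finset.mem_range_succ_iff.2 (Finset.le_sup (f := id) hi)⟩
  have box : (s : Set ℕ).pi t = (Finset.range (n + 1) : Set ℕ).pi t' := by
    ext u
    refine ⟨fun h i _ => ?_, fun h i hi => ?_⟩
    · dsimp only [t']; split_ifs with his; exacts [h i his, trivial]
    · simpa only [t', if_pos (Finset.mem_coe.1 hi)] using h i (hn hi)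
  have cons : (fun p : α × (ℕ → α) => seqCons p.1 p.2) ⁻¹' ((Finset.range (n + 1) : Set ℕ).pi t') =
      t' 0 ×ˢ ((Finset.range n : Set ℕ).pi fun i => t' (i + 1)) := by
    ext ⟨x, u⟩
    simp only [Set.mem_preimage, Set.mem_pi, Finset.coe_range, Set.mem_Iio, Set.mem_prod]
    rw [Nat.forall_lt_succ_left']
    rfl
  have prod : ∏ i ∈ s, ν (t i) = ∏ i ∈ Finset.range (n + 1), ν (t' i) := by
    rw [← Finset.prod_subset hn fun i _ hi => by simp [t', hi]]
    exact Finset.prod_congr rfl fun i hi => by simp [t', hi]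
  rw [Measure.map_apply measurable_seqCons (.pi s.countable_toSet fun i _ => ht i), box, cons,
    Measure.prod_prod, Measure.infinitePi_pi _ (fun i _ => ht' (i + 1)), prod,
    Finset.prod_range_succ', mul_comm]

end Sequences

section DiscreteTime

variable {S : Type*} [MeasurableSpace S]

/-- Law of the discrete-time Markov chain with transition kernel `κ` and initial distribution
`μ`. -/
def markovLaw (κ : Kernel S S) [IsMarkovKernel κ] (μ : Measure S) [IsProbabilityMeasure μ] :
    Measure (ℕ → S) :=
  Kernel.trajMeasure (X := fun _ => S) μ fun n =>
    κ.comap (fun past : (i : Finset.Iic n) → S => past ⟨n, Finset.mem_Iic.2 le_rfl⟩)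
      (measurable_pi_apply _)

variable (κ : Kernel S S) [IsMarkovKernel κ] (μ : Measure S) [IsProbabilityMeasure μ]

instance : IsProbabilityMeasure (markovLaw κ μ) := by
  unfold markovLaw; infer_instance

theorem lintegral_markovLaw {f : (ℕ → S) → ℝ≥0∞} (hf : Measurable f) :
    ∫⁻ u, f u ∂markovLaw κ μ = ∫⁻ x, ∫⁻ u, f u ∂markovLaw κ (Measure.dirac x) ∂μ := by
  let start : S → (Finset.Iic 0 → S) := (MeasurableEquiv.piUnique fun _ : Finset.Iic 0 => S).symm
  have traj : ∀ (ν : Measure S) [IsProbabilityMeasure ν], ∫⁻ u, f u ∂markovLaw κ ν =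
      ∫⁻ x, ∫⁻ u, f u ∂(Kernel.traj (X := fun _ => S) (fun n => κ.comap
        (fun past : (i : Finset.Iic n) → S => past ⟨n, Finset.mem_Iic.2 le_rfl⟩)
          (measurable_pi_apply _)) 0 (start x)) ∂ν := by
    intro ν _
    unfold markovLaw Kernel.trajMeasure
    rw [Measure.lintegral_bind (Kernel.aemeasurable _) hf.aemeasurable,
      lintegral_map hf.lintegral_kernel (by fun_prop)]
  rw [traj μ]
  refine lintegral_congr fun x => ?_
  rw [traj (Measure.dirac x), lintegral_dirac' _ ?_]
  exact hf.lintegral_kernel.comp (MeasurableEquiv.measurable _)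

theorem map_eval_zero_markovLaw : (markovLaw κ μ).map (fun u => u 0) = μ := by
  have eval : Measurable fun z : Finset.Iic 0 → S => z ⟨0, Finset.mem_Iic.2 le_rfl⟩ :=
    measurable_pi_apply _
  change (markovLaw κ μ).map ((fun z : Finset.Iic 0 → S => z ⟨0, Finset.mem_Iic.2 le_rfl⟩) ∘
    Preorder.frestrictLe (π := fun _ => S) 0) = μ
  rw [← Measure.map_map eval (by fun_prop)]
  unfold markovLaw Kernel.trajMeasure
  rw [Measure.map_comp _ _ (by fun_prop), Kernel.traj_map_frestrictLe, Kernel.partialTraj_self,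
    Measure.id_comp, Measure.map_map eval (by fun_prop)]
  exact Measure.map_id

variable [MeasurableSingletonClass S]

theorem measurableSet_cylinder (a : ℕ → S) (n : ℕ) : MeasurableSet (PiNat.cylinder a n) := by
  rw [PiNat.cylinder_eq_pi]
  exact .pi (Finset.countable_toSet _) fun i _ => measurableSet_singleton (a i)

theorem markovLaw_cylinder (a : ℕ → S) (n : ℕ) :
    markovLaw κ μ (PiNat.cylinder a (n + 1)) =
      μ {a 0} * ∏ i ∈ Finset.range n, κ (a i) {a (i + 1)} := by
  induction n with
  | zero =>
    have : PiNat.cylinder a 1 = (fun u => u 0) ⁻¹' {a 0} := by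
      ext u; simp [PiNat.mem_cylinder_iff]
    rw [this, ← Measure.map_apply (measurable_pi_apply 0) (measurableSet_singleton _),
      map_eval_zero_markovLaw]
    simp
  | succ n ih =>
    have split : PiNat.cylinder a (n + 2) =
        (fun u => (Preorder.frestrictLe (π := fun _ => S) n u, u (n + 1))) ⁻¹'
          ({Preorder.frestrictLe n a} ×ˢ {a (n + 1)}) := by
      rw [Set.mk_preimage_prod, frestrictLe_preimage_singleton]
      ext u
      simp only [PiNat.mem_cylinder_iff, Set.mem_inter_iff, Set.mem_preimage,
        Set.mem_singleton_iff, Nat.forall_lt_succ_right (n := n + 1)]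
    rw [split, ← Measure.map_apply (by fun_prop)
        ((measurableSet_singleton _).prod (measurableSet_singleton _)),
      markovLaw, ← Kernel.map_frestrictLe_trajMeasure_compProd_eq_map_trajMeasure,
      Measure.compProd_apply_prod (measurableSet_singleton _) (measurableSet_singleton _),
      lintegral_singleton, Measure.map_apply (by fun_prop) (measurableSet_singleton _),
      frestrictLe_preimage_singleton, ← markovLaw, ih, Finset.prod_range_succ, mul_comm, mul_assoc]
    rfl

variable [Countable S]

theorem measure_ext_cylinder {μ ν : Measure (ℕ → S)} [IsFiniteMeasure μ]
    (h : ∀ (a : ℕ → S) (n : ℕ),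
      μ (PiNat.cylinder a (n + 1)) = ν (PiNat.cylinder a (n + 1))) : μ = ν := by
  have restrict : ∀ n, ν.map (Preorder.frestrictLe (π := fun _ => S) n) =
      μ.map (Preorder.frestrictLe (π := fun _ => S) n) := by
    refine fun n => Measure.ext_of_singleton fun b => ?_
    obtain ⟨a, rfl⟩ : ∃ a : ℕ → S, Preorder.frestrictLe n a = b := by
      refine ⟨fun i => b ⟨min i n, Finset.mem_Iic.2 (min_le_right i n)⟩, funext fun i => ?_⟩
      rw [Preorder.frestrictLe_apply]
      congr 2
      exact min_eq_left (Finset.mem_Iic.1 i.2)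
    rw [Measure.map_apply (by fun_prop) (measurableSet_singleton _),
      Measure.map_apply (by fun_prop) (measurableSet_singleton _),
      frestrictLe_preimage_singleton, h]
  have proj : IsProjectiveMeasureFamily (α := fun _ : ℕ => S)
      (fun I : Finset ℕ => μ.map (I.restrict (π := fun _ => S))) := by
    intro I J hJI
    rw [Measure.map_map (by fun_prop) (by fun_prop)]
    rfl
  exact IsProjectiveLimit.unique (fun _ => rfl) ((isProjectiveLimit_nat_iff proj ν).2 restrict)

theorem markovLaw_dirac (x : S) :
    markovLaw κ (Measure.dirac x) = (markovLaw κ (κ x)).map (seqCons x) := by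
  refine measure_ext_cylinder fun a n => ?_
  rw [markovLaw_cylinder, Measure.map_apply (measurable_seqCons_right x)
    (measurableSet_cylinder a _), seqCons_preimage_cylinder_succ]
  by_cases hx : x = a 0
  · subst hx
    cases n with
    | zero => simp
    | succ n =>
      have tail : {u | a 0 = a 0 ∧ u ∈ PiNat.cylinder (fun i => a (i + 1)) (n + 1)} =
          PiNat.cylinder (fun i => a (i + 1)) (n + 1) := Set.ext fun _ => and_iff_right rfl
      rw [tail, markovLaw_cylinder, Finset.prod_range_succ', mul_comm (∏ _ ∈ _, _)]
      simp
  · simp [hx]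

theorem lintegral_markovLaw_dirac (x : S) {f : (ℕ → S) → ℝ≥0∞} (hf : Measurable f) :
    ∫⁻ u, f u ∂markovLaw κ (Measure.dirac x) =
      ∫⁻ z, ∫⁻ u, f (seqCons x u) ∂markovLaw κ (Measure.dirac z) ∂κ x := by
  rw [markovLaw_dirac, lintegral_map hf (measurable_seqCons_right x),
    lintegral_markovLaw κ (κ x) (f := fun u => f (seqCons x u))
      (hf.comp (measurable_seqCons_right x))]

end DiscreteTime

/-! ### Exponential clocks -/

section Exponential

theorem lintegral_expMeasure (r : ℝ) {f : ℝ → ℝ≥0∞} (hf : Measurable f) :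
    ∫⁻ s, f s ∂expMeasure r =
      ∫⁻ s in Set.Ici 0, ENNReal.ofReal (r * Real.exp (-(r * s))) * f s := by
  have density : expMeasure r = volume.withDensity (exponentialPDF r) := rfl
  have hm : Measurable (exponentialPDF r) := (measurable_exponentialPDFReal r).ennreal_ofReal
  rw [density, lintegral_withDensity_eq_lintegral_mul _ hm hf,
    ← setLIntegral_eq_of_support_subset (s := Set.Ici 0)]
  · refine setLIntegral_congr_fun measurableSet_Ici fun s hs => ?_
    simp only [Pi.mul_apply, exponentialPDF_of_nonneg hs]
  · intro s hs
    by_contra hneg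
    exact hs (by simp [exponentialPDF_of_neg (not_le.1 hneg)])

variable {r : ℝ}

theorem expMeasure_Ioi (hr : 0 < r) {s : ℝ} (hs : 0 ≤ s) :
    expMeasure r (Set.Ioi s) = ENNReal.ofReal (Real.exp (-(r * s))) := by
  have := isProbabilityMeasure_expMeasure hr
  rw [← Set.compl_Iic, prob_compl_eq_one_sub measurableSet_Iic, ← ofReal_cdf,
    cdf_expMeasure_eq hr, if_pos hs, ← ENNReal.ofReal_one, ← ENNReal.ofReal_sub]
  · ring_nf
  · simp only [sub_nonneg, Real.exp_le_one_iff]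
    nlinarith

theorem map_div_expMeasure_one (hr : 0 < r) :
    (expMeasure 1).map (fun s => s / r) = expMeasure r := by
  have := isProbabilityMeasure_expMeasure hr
  have := Measure.isProbabilityMeasure_map (μ := expMeasure 1) (f := fun s => s / r) (by fun_prop)
  refine Measure.eq_of_cdf _ _ (StieltjesFunction.ext fun x => ?_)
  have scale : (fun s => s / r) ⁻¹' Set.Iic x = Set.Iic (r * x) := by
    ext s
    simp only [Set.mem_preimage, Set.mem_Iic, div_le_iff₀' hr]
  rw [cdf_eq_real, map_measureReal_apply (by fun_prop) measurableSet_Iic, scale, ← cdf_eq_real,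
    cdf_expMeasure_eq one_pos, cdf_expMeasure_eq hr]
  simp only [one_mul, mul_nonneg_iff_of_pos_left hr]

theorem ae_expMeasure_pos (hr : 0 < r) : ∀ᵐ s ∂expMeasure r, 0 < s := by
  have := isProbabilityMeasure_expMeasure hr
  refine (prob_compl_eq_zero_iff measurableSet_Ioi).2 ?_
  simp [expMeasure_Ioi hr le_rfl]

theorem lintegral_expMeasure_pos (hr : 0 < r) {f : ℝ → ℝ≥0∞} (hf : Measurable f) {a b : ℝ}
    (ha : 0 ≤ a) (hab : a < b) (hpos : ∀ s ∈ Set.Ioo a b, f s ≠ 0) :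
    0 < ∫⁻ s, f s ∂expMeasure r := by
  rw [lintegral_expMeasure r hf, setLIntegral_pos_iff (by fun_prop)]
  have interval : Set.Ioo a b ⊆ Function.support
      (fun s => ENNReal.ofReal (r * Real.exp (-(r * s))) * f s) ∩ Set.Ici 0 := fun s hs =>
    ⟨mul_ne_zero (by simp [hr, Real.exp_pos]) (hpos s hs), ha.trans hs.1.le⟩
  exact lt_of_lt_of_le (by simpa using hab) (measure_mono interval)

-- Tonelli: the exponential density is `r` times the tail probability.
theorem lintegral_expMeasure_eq_mul_lintegral_Ico (hr : 0 < r) {f : ℝ → ℝ≥0∞} (hf : Measurable f) :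
    ∫⁻ s, f s ∂expMeasure r =
      ENNReal.ofReal r * ∫⁻ s, (∫⁻ u in Set.Ico 0 s, f u) ∂expMeasure r := by
  have := isProbabilityMeasure_expMeasure hr
  have tail : ∫⁻ s, (∫⁻ u in Set.Ico 0 s, f u) ∂expMeasure r =
      ∫⁻ u in Set.Ici 0, f u * expMeasure r (Set.Ioi u) := by
    have indicator : ∀ s, ∫⁻ u in Set.Ico 0 s, f u =
        ∫⁻ u in Set.Ici 0, f u * (Set.Ioi u).indicator 1 s := fun s => by
      rw [← lintegral_indicator measurableSet_Ico, ← lintegral_indicator measurableSet_Ici]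
      refine lintegral_congr fun u => ?_
      by_cases h0 : 0 ≤ u <;> by_cases hs : u < s <;> simp [h0, hs]
    have hm : Measurable fun p : ℝ × ℝ => f p.2 * (Set.Ioi p.2).indicator 1 p.1 :=
      (hf.comp measurable_snd).mul (measurable_one.indicator
        (measurableSet_lt measurable_snd measurable_fst) :
        Measurable ({p : ℝ × ℝ | p.2 < p.1}.indicator 1))
    simp_rw [indicator]
    rw [lintegral_lintegral_swap hm.aemeasurable]
    refine lintegral_congr fun u => ?_
    rw [lintegral_const_mul _ (measurable_one.indicator measurableSet_Ioi),
      lintegral_indicator_one measurableSet_Ioi]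
  rw [tail, lintegral_expMeasure r hf, ← lintegral_const_mul' _ _ ENNReal.ofReal_ne_top]
  refine setLIntegral_congr_fun measurableSet_Ici fun s hs => ?_
  simp only [expMeasure_Ioi hr hs, ENNReal.ofReal_mul hr.le]
  ring

theorem lintegral_ofReal_expMeasure (hr : 0 < r) :
    ∫⁻ s, ENNReal.ofReal s ∂expMeasure r = (ENNReal.ofReal r)⁻¹ := by
  have := isProbabilityMeasure_expMeasure hr
  have h := lintegral_expMeasure_eq_mul_lintegral_Ico hr (measurable_const (a := (1 : ℝ≥0∞)))
  simp only [lintegral_const, Measure.restrict_apply_univ, Real.volume_Ico, measure_univ,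
    one_mul, sub_zero] at h
  exact ENNReal.eq_inv_of_mul_eq_one_left (by rw [mul_comm, ← h])

theorem setLIntegral_Ioc_sub_right {F : ℝ → ℝ≥0∞} (hF : Measurable F) (a b s : ℝ) :
    ∫⁻ u in Set.Ioc a b, F (u - s) = ∫⁻ v in Set.Ioc (a - s) (b - s), F v := by
  have h := (measurePreserving_sub_right volume s).setLIntegral_comp_preimage
    (s := Set.Ioc (a - s) (b - s)) measurableSet_Ioc hF
  rwa [Set.preimage_sub_const_Ioc, sub_add_cancel, sub_add_cancel] at h

theorem setLIntegral_Ico_sub_left {F : ℝ → ℝ≥0∞} (hF : Measurable F) (a b t : ℝ) :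
    ∫⁻ u in Set.Ico a b, F (t - u) = ∫⁻ v in Set.Ioc (t - b) (t - a), F v := by
  have h := (Measure.measurePreserving_sub_left volume t).setLIntegral_comp_preimage
    (s := Set.Ioc (t - b) (t - a)) measurableSet_Ioc hF
  rwa [Set.preimage_const_sub_Ioc, sub_sub_cancel, sub_sub_cancel] at h

-- `lintegral_expMeasure_eq_mul_lintegral_Ico` for `s ↦ F (t - s)` turns the left-hand side into `r`
-- times the mean over `s` of the integral of `F` over `(-s, t]`.
theorem lintegral_expMeasure_sub_add (hr : 0 < r) {F : ℝ → ℝ≥0∞} (hF : Measurable F) {c : ℝ≥0∞}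
    (hneg : ∀ u < 0, F u = c) {t : ℝ} (ht : 0 ≤ t) :
    ∫⁻ s, F (t - s) ∂expMeasure r +
        ENNReal.ofReal r * ∫⁻ u in Set.Ioc 0 t, ∫⁻ s, F (u - s) ∂expMeasure r =
      c + ENNReal.ofReal r * ∫⁻ u in Set.Ioc 0 t, F u := by
  have := isProbabilityMeasure_expMeasure hr
  have pieces : ∀ s, 0 < s → (∫⁻ v in Set.Ioc (t - s) t, F v) +
      ∫⁻ v in Set.Ioc (-s) (t - s), F v = c * ENNReal.ofReal s + ∫⁻ v in Set.Ioc 0 t, F v := by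
    intro s hs
    have past : ∫⁻ v in Set.Ioc (-s) 0, F v = c * ENNReal.ofReal s := by
      rw [← setLIntegral_congr Ioo_ae_eq_Ioc,
        setLIntegral_congr_fun measurableSet_Ioo fun v hv => hneg v hv.2]
      simp
    rw [← past, add_comm, ← lintegral_union measurableSet_Ioc (Set.Ioc_disjoint_Ioc_of_le le_rfl),
      ← lintegral_union measurableSet_Ioc (Set.Ioc_disjoint_Ioc_of_le le_rfl),
      Set.Ioc_union_Ioc_eq_Ioc (by linarith) (by linarith),
      Set.Ioc_union_Ioc_eq_Ioc (by linarith) ht]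
  have hm : Measurable fun p : ℝ × ℝ => F (p.1 - p.2) := hF.comp measurable_sub
  have tonelli := lintegral_expMeasure_eq_mul_lintegral_Ico hr (hF.comp (measurable_const_sub t))
  simp only [Function.comp_apply, setLIntegral_Ico_sub_left hF, sub_zero] at tonelli
  rw [tonelli, lintegral_lintegral_swap hm.aemeasurable, ← mul_add, ← lintegral_add_right]
  · simp_rw [setLIntegral_Ioc_sub_right hF, zero_sub]
    rw [lintegral_congr_ae ((ae_expMeasure_pos hr).mono pieces), lintegral_add_right _
      measurable_const, lintegral_const_mul _ ENNReal.measurable_ofReal,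
      lintegral_ofReal_expMeasure hr, mul_add, mul_left_comm,
      ENNReal.mul_inv_cancel (by simpa using hr) ENNReal.ofReal_ne_top, mul_one]
    simp
  · exact hm.lintegral_prod_left'

end Exponential

/-- Law of a sequence of independent standard exponential clocks. -/
abbrev clockLaw : Measure (ℕ → ℝ) := Measure.infinitePi fun _ : ℕ => expMeasure 1

-- By the second Borel–Cantelli lemma, infinitely many clocks exceed `1`.
theorem ae_clockLaw_tsum_eq_top : ∀ᵐ ξ ∂clockLaw, ∑' n, ENNReal.ofReal (ξ n) = ∞ := by
  let long : ℕ → Set (ℕ → ℝ) := fun n => {ξ | 1 < ξ n}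
  have hlong : ∀ n, MeasurableSet (long n) := fun n =>
    measurableSet_lt measurable_const (measurable_pi_apply n)
  have indep : iIndepSet long clockLaw := by
    refine (iIndepSet_iff_meas_biInter hlong).2 fun t => ?_
    exact (iIndepFun_infinitePi (P := fun _ : ℕ => expMeasure 1) (X := fun _ x => x)
      fun _ => measurable_id).meas_biInter (S := t) fun i _ => ⟨Set.Ioi 1, measurableSet_Ioi, rfl⟩
  have prob : ∀ n, clockLaw (long n) = ENNReal.ofReal (Real.exp (-1)) := fun n => by
    have h := (measurePreserving_eval_infinitePi (fun _ : ℕ => expMeasure 1) n).measure_preimage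
      (measurableSet_Ioi (a := (1 : ℝ))).nullMeasurableSet
    rw [expMeasure_Ioi one_pos zero_le_one, mul_one] at h
    exact h
  have often : ∀ᵐ ξ ∂clockLaw, ξ ∈ Filter.limsup long Filter.atTop := by
    refine (prob_compl_eq_zero_iff (.measurableSet_limsup hlong)).2
      (measure_limsup_eq_one hlong indep ?_)
    simp only [prob]
    exact ENNReal.tsum_const_eq_top_of_ne_zero (by simp [Real.exp_pos])
  filter_upwards [often] with ξ hξ
  by_contra hne
  obtain ⟨n, hn, hn'⟩ := ((Filter.mem_limsup_iff_frequently_mem.1 hξ).and_eventually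
    ((ENNReal.tendsto_atTop_zero_of_tsum_ne_top hne).eventually_lt_const one_pos)).exists
  exact absurd hn' (not_lt.2 (ENNReal.one_le_ofReal.2 (le_of_lt hn)))

/-! ### Decomposition at the first jump -/

namespace RateMatrix

section Rates

variable {S : Type*} (Q : RateMatrix S)

theorem rate_eq_zero_of_exitRate_eq_zero {x : S} (hx : Q.exitRate x = 0) (y : S) :
    Q.rate x y = 0 := by
  have h := Q.tsum_rate_eq x
  rw [hx, ENNReal.coe_zero, ENNReal.tsum_eq_zero] at h
  exact_mod_cast h y

theorem exitRate_mul_jumpKernel_singleton [MeasurableSpace S] [DiscreteMeasurableSpace S]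
    (x y : S) :
    (Q.exitRate x : ℝ≥0∞) * Q.jumpKernel x {y} = Q.rate x y := by
  have single : Q.jumpKernel x {y} = Q.jumpPMF x y :=
    PMF.toMeasure_apply_singleton _ _ (measurableSet_singleton y)
  rw [single]
  by_cases hx : Q.exitRate x = 0
  · simp [hx, Q.rate_eq_zero_of_exitRate_eq_zero hx y]
  · rw [jumpPMF, dif_neg hx, PMF.normalize_apply, Q.tsum_rate_eq, mul_left_comm,
      ENNReal.mul_inv_cancel (by exact_mod_cast hx) ENNReal.coe_ne_top, mul_one]

end Rates

section Paths

variable {S : Type*} (Q : RateMatrix S)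

theorem jumpTime_mono (ω : Path S) : Monotone fun n => Q.jumpTime n ω :=
  fun _ _ h => Finset.sum_le_sum_of_subset (Finset.range_subset_range.2 h)

theorem state_eq_some_iff (t : ℝ≥0) (ω : Path S) (y : S) :
    Q.state t ω = some y ↔ ∃ n, Q.jumpTime n ω ≤ t ∧ t < Q.jumpTime (n + 1) ω ∧ ω.1 n = y := by
  classical
  unfold state
  constructor
  · intro h
    split_ifs at h with hex
    refine ⟨Nat.find hex, ?_, Nat.find_spec hex, Option.some_injective _ h⟩
    rcases hn : Nat.find hex with _ | n
    · simp [jumpTime]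
    · exact not_lt.1 (Nat.find_min hex (hn ▸ n.lt_succ_self))
  · rintro ⟨n, hn, hn', rfl⟩
    have hex : ∃ n, (t : ℝ≥0∞) < Q.jumpTime (n + 1) ω := ⟨n, hn'⟩
    have first : Nat.find hex = n := (Nat.find_eq_iff hex).2
      ⟨hn', fun m hm => not_lt.2 ((Q.jumpTime_mono ω (Nat.succ_le_of_lt hm)).trans hn)⟩
    rw [dif_pos hex, first]

theorem state_isSome (t : ℝ≥0) {ω : Path S} (h : ∑' n, Q.holding n ω = ∞) :
    (Q.state t ω).isSome := by
  have hex : ∃ n, (t : ℝ≥0∞) < Q.jumpTime (n + 1) ω := by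
    by_contra! hc
    refine ENNReal.coe_ne_top (top_le_iff.1 (h ▸ ?_ : ∞ ≤ (t : ℝ≥0∞)))
    rw [ENNReal.tsum_eq_iSup_nat]
    exact iSup_le fun n => (Q.jumpTime_mono ω n.le_succ).trans (hc n)
  rw [state, dif_pos hex, Option.isSome_some]

theorem jumpTime_seqCons_succ (x : S) (s : ℝ) (ω : Path S) (n : ℕ) :
    Q.jumpTime (n + 1) (seqCons x ω.1, seqCons s ω.2) =
      ENNReal.ofReal s / Q.exitRate x + Q.jumpTime n ω := by
  rw [jumpTime, Finset.sum_range_succ', add_comm]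
  rfl

theorem state_seqCons_of_lt {t : ℝ≥0} {x : S} {s : ℝ} (ω : Path S)
    (ht : (t : ℝ≥0∞) < ENNReal.ofReal s / Q.exitRate x) :
    Q.state t (seqCons x ω.1, seqCons s ω.2) = some x := by
  refine (Q.state_eq_some_iff t _ x).2 ⟨0, by simp [jumpTime], ?_, rfl⟩
  rw [jumpTime_seqCons_succ]
  exact ht.trans_le le_self_add

theorem state_seqCons_of_le {t : ℝ≥0} {x : S} {s : ℝ} (ω : Path S)
    (ht : ENNReal.ofReal s / Q.exitRate x ≤ t) :
    Q.state t (seqCons x ω.1, seqCons s ω.2) =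
      Q.state (t - (ENNReal.ofReal s / Q.exitRate x).toNNReal) ω := by
  set h := ENNReal.ofReal s / Q.exitRate x with hdef
  have hfin : h ≠ ∞ := (ht.trans_lt ENNReal.coe_lt_top).ne
  have ht' : (t : ℝ≥0∞) = h + (t - h.toNNReal : ℝ≥0) := by
    rw [ENNReal.coe_sub, ENNReal.coe_toNNReal hfin, add_tsub_cancel_of_le ht]
  ext y
  have notFirst : ¬ (t : ℝ≥0∞) < Q.jumpTime 1 (seqCons x ω.1, seqCons s ω.2) := by
    rw [jumpTime_seqCons_succ]
    simpa [jumpTime] using ht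
  rw [state_eq_some_iff, state_eq_some_iff, ← Nat.or_exists_add_one,
    or_iff_right fun hn => notFirst hn.2.1]
  refine exists_congr fun n => ?_
  rw [jumpTime_seqCons_succ, jumpTime_seqCons_succ, ← hdef, ht',
    ENNReal.add_le_add_iff_left hfin, ENNReal.add_lt_add_iff_left hfin]
  rfl

end Paths

section Law

variable {S : Type*} [MeasurableSpace S] [DiscreteMeasurableSpace S] (Q : RateMatrix S)

variable (μ : Measure S) [IsProbabilityMeasure μ]

theorem law_eq_prod : Q.law μ = (markovLaw Q.jumpKernel μ).prod clockLaw := rfl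

instance : IsProbabilityMeasure (Q.law μ) := by
  rw [law_eq_prod]; infer_instance

instance (x : S) : IsProbabilityMeasure (Q.lawFrom x) := by
  unfold lawFrom; infer_instance

variable [Countable S]

theorem lintegral_law {f : Path S → ℝ≥0∞} (hf : Measurable f) :
    ∫⁻ ω, f ω ∂Q.law μ = ∑' x, μ {x} * ∫⁻ ω, f ω ∂Q.lawFrom x := by
  rw [law_eq_prod, lintegral_prod f hf.aemeasurable,
    lintegral_markovLaw _ _ hf.lintegral_prod_right', lintegral_countable']
  refine tsum_congr fun x => ?_
  rw [lawFrom, law_eq_prod, lintegral_prod f hf.aemeasurable, mul_comm]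

theorem law_apply {E : Set (Path S)} (hE : MeasurableSet E) :
    Q.law μ E = ∑' x, μ {x} * Q.lawFrom x E := by
  simpa only [lintegral_indicator_one hE] using
    Q.lintegral_law μ (f := E.indicator 1) (measurable_one.indicator hE)

theorem lintegral_lawFrom (x : S) {f : Path S → ℝ≥0∞} (hf : Measurable f) :
    ∫⁻ ω, f ω ∂Q.lawFrom x = ∫⁻ s, ∫⁻ ω, f (seqCons x ω.1, seqCons s ω.2)
      ∂Q.law (Q.jumpKernel x) ∂expMeasure 1 := by
  have hg : ∀ s, Measurable fun ω : Path S => f (seqCons x ω.1, seqCons s ω.2) := fun s =>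
    hf.comp ((measurable_seqCons_right x).prodMap (measurable_seqCons_right s))
  have hg' : Measurable fun p : ℝ × (ℕ → ℝ) =>
      ∫⁻ u, f (u, seqCons p.1 p.2) ∂markovLaw Q.jumpKernel (Measure.dirac x) :=
    hf.lintegral_prod_left'.comp measurable_seqCons
  have clocks : clockLaw = ((expMeasure 1).prod clockLaw).map fun p => seqCons p.1 p.2 :=
    infinitePi_eq_map_seqCons (expMeasure 1)
  rw [lawFrom, law_eq_prod, lintegral_prod_symm' f hf, clocks,
    lintegral_map hf.lintegral_prod_left' measurable_seqCons, lintegral_prod _ hg'.aemeasurable]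
  refine lintegral_congr fun s => ?_
  rw [law_eq_prod, lintegral_prod_symm' _ (hg s)]
  refine lintegral_congr fun ξ => ?_
  rw [markovLaw_dirac]
  exact lintegral_map (f := fun u => f (u, seqCons s ξ)) (hf.comp measurable_prodMk_right)
    (measurable_seqCons_right x)

theorem exitRate_mul_law_jumpKernel (x : S) {E : Set (Path S)} (hE : MeasurableSet E) :
    Q.exitRate x * Q.law (Q.jumpKernel x) E = ∑' z, Q.rate x z * Q.lawFrom z E := by
  rw [Q.law_apply _ hE, ← ENNReal.tsum_mul_left]
  refine tsum_congr fun z => ?_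
  rw [← mul_assoc, exitRate_mul_jumpKernel_singleton]

end Law

end RateMatrix

/-! ### The transition function -/

namespace RateMatrix

variable {S : Type*} [MeasurableSpace S] [DiscreteMeasurableSpace S] (Q : RateMatrix S)

theorem measurable_holding (n : ℕ) : Measurable (Q.holding n) := by
  have clock : Measurable fun ω : Path S => ENNReal.ofReal (ω.2 n) :=
    ((measurable_pi_apply n).comp measurable_snd).ennreal_ofReal
  have rate : Measurable fun x : S => (Q.exitRate x : ℝ≥0∞) := .of_discrete
  exact clock.div (rate.comp ((measurable_pi_apply n).comp measurable_fst))

theorem measurable_jumpTime (n : ℕ) : Measurable (Q.jumpTime n) :=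
  Finset.measurable_fun_sum _ fun k _ => Q.measurable_holding k

open Classical in
theorem law_jumpKernel_state_seqCons_of_lt {t : ℝ≥0} {x : S} {s : ℝ} (y : S)
    (ht : (t : ℝ≥0∞) < ENNReal.ofReal s / Q.exitRate x) :
    Q.law (Q.jumpKernel x) {ω | Q.state t (seqCons x ω.1, seqCons s ω.2) = some y} =
      if x = y then 1 else 0 := by
  simp only [Q.state_seqCons_of_lt _ ht, Option.some_inj]
  split_ifs with h <;> simp [h]

open Classical in
/-- The probability that the chain started from `x` is in `y` at time `u` after its first jump. A
negative `u` stands for a time before this jump, when the chain is still in `x`. -/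
def afterJump (x y : S) (u : ℝ) : ℝ≥0∞ :=
  if u < 0 then if x = y then 1 else 0
  else Q.law (Q.jumpKernel x) {ω | Q.state u.toNNReal ω = some y}

theorem law_jumpKernel_state_seqCons {x : S} (hx : Q.exitRate x ≠ 0) (t : ℝ≥0) (y : S) {s : ℝ}
    (hs : 0 ≤ s) :
    Q.law (Q.jumpKernel x) {ω | Q.state t (seqCons x ω.1, seqCons s ω.2) = some y} =
      Q.afterJump x y (t - s / Q.exitRate x) := by
  have hold : ENNReal.ofReal s / Q.exitRate x = ENNReal.ofReal (s / Q.exitRate x) := by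
    rw [ENNReal.ofReal_div_of_pos (by positivity), ENNReal.ofReal_coe_nnreal]
  have hpos : 0 ≤ s / Q.exitRate x := by positivity
  unfold afterJump
  by_cases hlt : (t : ℝ) < s / Q.exitRate x
  · rw [if_pos (sub_neg.2 hlt), Q.law_jumpKernel_state_seqCons_of_lt]
    rw [hold]
    exact (ENNReal.lt_ofReal_iff_toReal_lt ENNReal.coe_ne_top).2 hlt
  · have hle : ENNReal.ofReal s / Q.exitRate x ≤ t := by
      rw [hold, ENNReal.ofReal_le_iff_le_toReal ENNReal.coe_ne_top]
      exact not_lt.1 hlt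
    have time : (t - s / Q.exitRate x : ℝ).toNNReal =
        t - (ENNReal.ofReal s / Q.exitRate x).toNNReal := by
      rw [hold, NNReal.sub_def, ENNReal.ofReal, ENNReal.toNNReal_coe, Real.coe_toNNReal _ hpos]
    simp only [if_neg (not_lt.2 (sub_nonneg.2 (not_lt.1 hlt))), Q.state_seqCons_of_le _ hle, time]

variable {Q} in
theorem isNonexplosive_of_exitRate_le {B : ℝ≥0} (hB : ∀ x, Q.exitRate x ≤ B) :
    Q.IsNonexplosive := by
  intro x
  have clocks : ∀ᵐ ω ∂Q.lawFrom x, ∑' n, ENNReal.ofReal (ω.2 n) = ∞ :=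
    Measure.quasiMeasurePreserving_snd.ae ae_clockLaw_tsum_eq_top
  filter_upwards [clocks] with ω hω
  refine top_le_iff.1 ?_
  calc ∞ = (∑' n, ENNReal.ofReal (ω.2 n)) / B := by rw [hω, ENNReal.top_div_coe]
    _ = ∑' n, ENNReal.ofReal (ω.2 n) / B := by
      simp only [div_eq_mul_inv, ENNReal.tsum_mul_right]
    _ ≤ ∑' n, Q.holding n ω := ENNReal.tsum_le_tsum fun n =>
      ENNReal.div_le_div_left (by exact_mod_cast hB _) _

variable [Countable S]

theorem measurableSet_state_prod (y : S) :
    MeasurableSet {p : ℝ≥0 × Path S | Q.state p.1 p.2 = some y} := by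
  have time : Measurable fun p : ℝ≥0 × Path S => (p.1 : ℝ≥0∞) := measurable_fst.coe_nnreal_ennreal
  have jump : ∀ n, Measurable fun p : ℝ≥0 × Path S => Q.jumpTime n p.2 := fun n =>
    (Q.measurable_jumpTime n).comp measurable_snd
  have visited : ∀ n, Measurable fun p : ℝ≥0 × Path S => p.2.1 n := fun n =>
    (measurable_pi_apply n).comp measurable_snd.fst
  simp only [state_eq_some_iff, Set.ofPred_exists]
  exact .iUnion fun n => (measurableSet_le (jump n) time).inter
    ((measurableSet_lt time (jump (n + 1))).inter (visited n (measurableSet_singleton y)))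

theorem measurableSet_state (t : ℝ≥0) (y : S) :
    MeasurableSet {ω : Path S | Q.state t ω = some y} :=
  measurable_prodMk_left (Q.measurableSet_state_prod y)

/-- The transition function of the chain: the probability to be in `y` at time `t` when started
from `x`. -/
def transProb (t : ℝ≥0) (x y : S) : ℝ≥0∞ :=
  Q.lawFrom x {ω | Q.state t ω = some y}

theorem measurable_transProb (x y : S) : Measurable fun t => Q.transProb t x y :=
  measurable_measure_prodMk_left (Q.measurableSet_state_prod y)

theorem law_state (μ : Measure S) [IsProbabilityMeasure μ] (t : ℝ≥0) (y : S) :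
    Q.law μ {ω | Q.state t ω = some y} = ∑' x, μ {x} * Q.transProb t x y :=
  Q.law_apply μ (Q.measurableSet_state t y)

theorem measurable_afterJump (x y : S) : Measurable (Q.afterJump x y) :=
  .ite measurableSet_Iio measurable_const
    ((measurable_measure_prodMk_left (Q.measurableSet_state_prod y)).comp measurable_real_toNNReal)

theorem exitRate_mul_afterJump (x y : S) {u : ℝ} (hu : 0 ≤ u) :
    Q.exitRate x * Q.afterJump x y u = ∑' z, Q.rate x z * Q.transProb u.toNNReal z y := by
  rw [afterJump, if_neg (not_lt.2 hu),
    Q.exitRate_mul_law_jumpKernel x (Q.measurableSet_state _ y)]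
  rfl

theorem transProb_eq_lintegral_law (t : ℝ≥0) (x y : S) :
    Q.transProb t x y = ∫⁻ s, Q.law (Q.jumpKernel x)
      {ω | Q.state t (seqCons x ω.1, seqCons s ω.2) = some y} ∂expMeasure 1 := by
  have hE := Q.measurableSet_state t y
  rw [transProb, ← lintegral_indicator_one hE,
    Q.lintegral_lawFrom x (measurable_one.indicator hE)]
  refine lintegral_congr fun s => ?_
  exact lintegral_indicator_one
    (((measurable_seqCons_right x).prodMap (measurable_seqCons_right s)) hE)

theorem transProb_eq_lintegral_afterJump {x : S} (hx : Q.exitRate x ≠ 0) (t : ℝ≥0) (y : S) :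
    Q.transProb t x y = ∫⁻ s, Q.afterJump x y (t - s) ∂expMeasure (Q.exitRate x) := by
  have hm : Measurable fun s : ℝ => Q.afterJump x y (t - s) :=
    (Q.measurable_afterJump x y).comp (measurable_const_sub _)
  rw [transProb_eq_lintegral_law, ← map_div_expMeasure_one (r := Q.exitRate x) (by positivity),
    lintegral_map hm (by fun_prop)]
  exact lintegral_congr_ae ((ae_expMeasure_pos one_pos).mono fun s hs =>
    Q.law_jumpKernel_state_seqCons hx t y hs.le)

open Classical in
theorem transProb_of_exitRate_eq_zero {x : S} (hx : Q.exitRate x = 0) (t : ℝ≥0) (y : S) :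
    Q.transProb t x y = if x = y then 1 else 0 := by
  rw [transProb_eq_lintegral_law, lintegral_congr_ae ((ae_expMeasure_pos one_pos).mono
    fun s hs => Q.law_jumpKernel_state_seqCons_of_lt y ?_)]
  · simp
  · simp [hx, ENNReal.div_zero, hs]

open Classical in
theorem transProb_add_lintegral (t : ℝ≥0) (x y : S) :
    Q.transProb t x y + Q.exitRate x * ∫⁻ u in Set.Ioc 0 (t : ℝ), Q.transProb u.toNNReal x y =
      (if x = y then 1 else 0) +
        ∫⁻ u in Set.Ioc 0 (t : ℝ), ∑' z, Q.rate x z * Q.transProb u.toNNReal z y := by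
  by_cases hx : Q.exitRate x = 0
  · simp [Q.transProb_of_exitRate_eq_zero hx, hx, Q.rate_eq_zero_of_exitRate_eq_zero hx]
  have backward := lintegral_expMeasure_sub_add (r := Q.exitRate x) (by positivity)
    (Q.measurable_afterJump x y) (fun u hu => if_pos hu) t.coe_nonneg
  rw [← Q.transProb_eq_lintegral_afterJump hx, ENNReal.ofReal_coe_nnreal,
    ← lintegral_const_mul _ (Q.measurable_afterJump x y),
    setLIntegral_congr_fun measurableSet_Ioc fun u hu => Q.exitRate_mul_afterJump x y hu.1.le]
    at backward
  rw [← backward]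
  congr 2
  refine setLIntegral_congr_fun measurableSet_Ioc fun u hu => ?_
  rw [Q.transProb_eq_lintegral_afterJump hx, Real.coe_toNNReal _ hu.1.le]

theorem transProb_self_pos (t : ℝ≥0) (x : S) : 0 < Q.transProb t x x := by
  by_cases hx : Q.exitRate x = 0
  · simp [Q.transProb_of_exitRate_eq_zero hx]
  rw [Q.transProb_eq_lintegral_afterJump hx]
  refine lintegral_expMeasure_pos (by positivity)
    ((Q.measurable_afterJump x x).comp (measurable_const_sub _)) t.coe_nonneg
    (lt_add_one (t : ℝ)) fun s hs => ?_
  simp [afterJump, hs.1]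

theorem transProb_pos_of_rate {x z y : S} (hxz : Q.rate x z ≠ 0)
    (hzy : ∀ u, 0 < u → 0 < Q.transProb u z y) {t : ℝ≥0} (ht : 0 < t) :
    0 < Q.transProb t x y := by
  have hx : Q.exitRate x ≠ 0 := fun h => hxz (Q.rate_eq_zero_of_exitRate_eq_zero h z)
  rw [Q.transProb_eq_lintegral_afterJump hx]
  refine lintegral_expMeasure_pos (by positivity)
    ((Q.measurable_afterJump x y).comp (measurable_const_sub _)) le_rfl
    (NNReal.coe_pos.2 ht) fun s hs => right_ne_zero_of_mul (a := (Q.exitRate x : ℝ≥0∞)) ?_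
  rw [Q.exitRate_mul_afterJump x y (sub_nonneg.2 hs.2.le), Ne, ENNReal.tsum_eq_zero, not_forall]
  exact ⟨z, mul_ne_zero (by exact_mod_cast hxz)
    (hzy _ (Real.toNNReal_pos.2 (sub_pos.2 hs.2))).ne'⟩

theorem transProb_pos {x y : S} (h : Relation.ReflTransGen (fun x z => Q.rate x z ≠ 0) x y)
    {t : ℝ≥0} (ht : 0 < t) : 0 < Q.transProb t x y := by
  induction h using Relation.ReflTransGen.head_induction_on generalizing t with
  | refl => exact Q.transProb_self_pos t y
  | head hxz _ ih => exact Q.transProb_pos_of_rate hxz (fun _ => ih) ht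

theorem isIrreducible_of_reflTransGen
    (h : ∀ x y, Relation.ReflTransGen (fun x z => Q.rate x z ≠ 0) x y) : Q.IsIrreducible :=
  fun x y => ⟨1, Q.transProb_pos (h x y) one_pos⟩

variable {Q}

theorem IsNonexplosive.ae_law (hQ : Q.IsNonexplosive) (μ : Measure S) [IsProbabilityMeasure μ] :
    ∀ᵐ ω ∂Q.law μ, ∑' n, Q.holding n ω = ∞ := by
  have hm : MeasurableSet {ω : Path S | ∑' n, Q.holding n ω = ∞}ᶜ :=
    (measurableSet_eq_fun (.tsum Q.measurable_holding) measurable_const).compl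
  refine (Q.law_apply μ hm).trans (ENNReal.tsum_eq_zero.2 fun x => ?_)
  exact mul_eq_zero_of_right _ (hQ x)

theorem IsNonexplosive.tsum_law_state (hQ : Q.IsNonexplosive) (μ : Measure S)
    [IsProbabilityMeasure μ] (t : ℝ≥0) : ∑' y, Q.law μ {ω | Q.state t ω = some y} = 1 := by
  rw [← measure_iUnion]
  · refine (prob_compl_eq_zero_iff (.iUnion fun y => Q.measurableSet_state t y)).1
      ((hQ.ae_law μ).mono fun ω hω => ?_)
    exact Set.mem_iUnion.2 (Option.isSome_iff_exists.1 (Q.state_isSome t hω))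
  · exact fun y z hyz => Set.disjoint_left.2 fun ω hy hz =>
      hyz (Option.some_injective _ (hy.symm.trans hz))
  · exact Q.measurableSet_state t

theorem IsNonexplosive.tsum_transProb (hQ : Q.IsNonexplosive) (t : ℝ≥0) (x : S) :
    ∑' y, Q.transProb t x y = 1 :=
  hQ.tsum_law_state _ t

end RateMatrix

/-! ### Balance and equilibrium -/

theorem eq_of_le_of_tsum_eq {α : Type*} {a b : α → ℝ≥0∞} (hab : a ≤ b) (hfin : ∑' x, a x ≠ ∞)
    (h : ∑' x, a x = ∑' x, b x) : a = b := by
  by_contra hne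
  obtain ⟨x, hx⟩ := Function.ne_iff.1 hne
  exact (ENNReal.tsum_lt_tsum hfin hab (lt_of_le_of_ne (hab x) hx)).ne h

section TransitionMatrix

variable {S : Type*}

/-- The distribution after one step, of a discrete-time chain with transition matrix `K` and
distribution `p` before this step. The invariant distributions are its fixed points. -/
def stepDist (K : S → S → ℝ≥0∞) (p : S → ℝ≥0∞) (y : S) : ℝ≥0∞ := ∑' x, p x * K x y

/-- A transition matrix all of whose rows have sum `1`. -/
def IsStochasticMatrix (K : S → S → ℝ≥0∞) : Prop := ∀ x, ∑' y, K x y = 1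

variable {K : S → S → ℝ≥0∞} {p p' : S → ℝ≥0∞}

theorem stepDist_mono (h : p ≤ p') : stepDist K p ≤ stepDist K p' :=
  fun y => ENNReal.tsum_le_tsum fun x => mul_le_mul_left (h x) (K x y)

theorem IsStochasticMatrix.ne_top (hK : IsStochasticMatrix K) (x y : S) : K x y ≠ ∞ :=
  ne_top_of_le_ne_top ENNReal.one_ne_top ((ENNReal.le_tsum y).trans_eq (hK x))

theorem IsStochasticMatrix.tsum_stepDist (hK : IsStochasticMatrix K) (p : S → ℝ≥0∞) :
    ∑' y, stepDist K p y = ∑' x, p x := by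
  simp only [stepDist]
  rw [ENNReal.tsum_comm]
  simp_rw [ENNReal.tsum_mul_left, hK _, mul_one]

theorem IsStochasticMatrix.stepDist_eq_of_le (hK : IsStochasticMatrix K) (hp : ∑' x, p x ≠ ∞)
    (h : stepDist K p ≤ p) : stepDist K p = p :=
  eq_of_le_of_tsum_eq h (by rwa [hK.tsum_stepDist]) (hK.tsum_stepDist p)

theorem IsStochasticMatrix.eq_of_le_of_apply_eq (hK : IsStochasticMatrix K)
    (hpos : ∀ x y, K x y ≠ 0) (hp : stepDist K p = p) (hp' : stepDist K p' = p') (hle : p ≤ p')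
    {x : S} (hx : p x = p' x) (hfin : p x ≠ ∞) : p = p' := by
  have flow : (fun z => p z * K z x) = fun z => p' z * K z x :=
    eq_of_le_of_tsum_eq (fun z => mul_le_mul_left (hle z) (K z x))
      (ne_of_eq_of_ne (congrFun hp x) hfin)
      ((congrFun hp x).trans (hx.trans (congrFun hp' x).symm))
  exact funext fun z => (ENNReal.mul_left_inj (hpos z x) (hK.ne_top z x)).1 (congrFun flow z)

theorem IsStochasticMatrix.eq_of_stepDist_eq (hK : IsStochasticMatrix K)
    (hpos : ∀ x y, K x y ≠ 0) (hp : stepDist K p = p) (hp' : stepDist K p' = p')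
    (hfin : ∑' x, p x ≠ ∞) (hmass : ∑' x, p x = ∑' x, p' x) : p = p' := by
  rcases isEmpty_or_nonempty S with hS | ⟨⟨x⟩⟩
  · exact Subsingleton.elim _ _
  wlog hx : p x ≤ p' x generalizing p p'
  · exact (this hp' hp (hmass ▸ hfin) hmass.symm (le_of_not_ge hx)).symm
  have minFin : ∑' z, (p ⊓ p') z ≠ ∞ :=
    ne_top_of_le_ne_top hfin (ENNReal.tsum_le_tsum fun z => inf_le_left)
  have minInvariant : stepDist K (p ⊓ p') = p ⊓ p' :=
    hK.stepDist_eq_of_le minFin (le_inf ((stepDist_mono inf_le_left).trans_eq hp)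
      ((stepDist_mono inf_le_right).trans_eq hp'))
  have minEq : p ⊓ p' = p :=
    hK.eq_of_le_of_apply_eq hpos minInvariant hp inf_le_left (inf_eq_left.2 hx)
      (ENNReal.ne_top_of_tsum_ne_top minFin x)
  exact eq_of_le_of_tsum_eq (inf_eq_left.1 minEq) hfin hmass

end TransitionMatrix

theorem tsum_measure_singleton {S : Type*} [Countable S] [MeasurableSpace S]
    [MeasurableSingletonClass S] (μ : Measure S) [IsProbabilityMeasure μ] : ∑' x, μ {x} = 1 := by
  simpa using (lintegral_countable' (μ := μ) fun _ => 1).symm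

namespace RateMatrix

variable {S : Type*} {Q : RateMatrix S}

/-- The global balance equations for the weights `p`: the flow into every state equals the flow out
of it. -/
def IsBalanced (Q : RateMatrix S) (p : S → ℝ≥0∞) : Prop :=
  ∀ y, ∑' x, p x * Q.rate x y = p y * Q.exitRate y

theorem IsBalanced.tsum_mul_tsum_rate_mul {p : S → ℝ≥0∞} (hp : Q.IsBalanced p) (f : S → ℝ≥0∞) :
    ∑' x, p x * ∑' z, Q.rate x z * f z = ∑' x, p x * Q.exitRate x * f x := by
  simp_rw [← hp _, ← ENNReal.tsum_mul_left, ← ENNReal.tsum_mul_right]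
  rw [ENNReal.tsum_comm]
  simp_rw [mul_assoc]

variable [Countable S] [MeasurableSpace S] [DiscreteMeasurableSpace S]

theorem IsBalanced.stepDist_transProb {p : S → ℝ≥0∞} (hp : Q.IsBalanced p)
    (hflux : ∑' x, p x * Q.exitRate x ≠ ∞) (t : ℝ≥0) : stepDist (Q.transProb t) p = p := by
  classical
  ext y
  let P : S → ℝ → ℝ≥0∞ := fun x u => Q.transProb u.toNNReal x y
  let I : (ℝ → ℝ≥0∞) → ℝ≥0∞ := fun F => ∫⁻ u in Set.Ioc 0 (t : ℝ), F u
  let flux : ℝ → ℝ≥0∞ := fun u => ∑' x, p x * Q.exitRate x * P x u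
  have hP : ∀ x, Measurable (P x) := fun x =>
    (Q.measurable_transProb x y).comp measurable_real_toNNReal
  have hPsum : ∀ x, Measurable fun u => ∑' z, Q.rate x z * P z u := fun x =>
    .tsum fun z => (hP z).const_mul _
  have outflow : ∑' x, p x * (Q.exitRate x * I (P x)) = I flux := by
    simp only [I, flux]
    rw [lintegral_tsum fun x => ((hP x).const_mul _).aemeasurable]
    exact tsum_congr fun x => by rw [lintegral_const_mul _ (hP x), mul_assoc]
  have inflow : ∑' x, p x * I (fun u => ∑' z, Q.rate x z * P z u) = I flux := by
    simp only [I, flux, ← lintegral_const_mul _ (hPsum _)]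
    rw [← lintegral_tsum fun x => ((hPsum x).const_mul _).aemeasurable]
    exact lintegral_congr fun u => hp.tsum_mul_tsum_rate_mul fun z => P z u
  have finite : I flux ≠ ∞ := by
    refine ne_top_of_le_ne_top (b := I fun _ => ∑' x, p x * Q.exitRate x) ?_
      (lintegral_mono fun u => ENNReal.tsum_le_tsum fun x => mul_le_of_le_one_right' prob_le_one)
    simpa [I] using ENNReal.mul_ne_top hflux ENNReal.coe_ne_top
  refine (ENNReal.add_left_inj finite).1 ?_
  calc stepDist (Q.transProb t) p y + I flux
      = ∑' x, p x * (Q.transProb t x y + Q.exitRate x * I (P x)) := by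
        rw [← outflow, stepDist, ← ENNReal.tsum_add]
        simp only [mul_add]
    _ = ∑' x, p x * ((if x = y then 1 else 0) + I fun u => ∑' z, Q.rate x z * P z u) := by
        simp only [I, P, Q.transProb_add_lintegral]
    _ = p y + I flux := by simp [mul_add, ENNReal.tsum_add, inflow]

theorem IsBalanced.isEquilibrium {π : ProbabilityMeasure S}
    (hπ : Q.IsBalanced fun x => (π : Measure S) {x})
    (hflux : ∑' x, (π : Measure S) {x} * Q.exitRate x ≠ ∞) : Q.IsEquilibrium π :=
  fun t y => (Q.law_state π t y).trans (congrFun (hπ.stepDist_transProb hflux t) y)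

theorem IsEquilibrium.stepDist_transProb {π : ProbabilityMeasure S} (h : Q.IsEquilibrium π)
    (t : ℝ≥0) : stepDist (Q.transProb t) (fun x => (π : Measure S) {x}) =
      fun y => (π : Measure S) {y} :=
  funext fun y => (Q.law_state π t y).symm.trans (h t y)

theorem IsEquilibrium.eq (hQ : Q.IsNonexplosive) {t : ℝ≥0} (hpos : ∀ x y, Q.transProb t x y ≠ 0)
    {π π' : ProbabilityMeasure S} (h : Q.IsEquilibrium π) (h' : Q.IsEquilibrium π') : π = π' := by
  have mass : ∀ ρ : ProbabilityMeasure S, ∑' x, (ρ : Measure S) {x} = 1 := fun ρ =>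
    tsum_measure_singleton _
  have singletons := IsStochasticMatrix.eq_of_stepDist_eq (hQ.tsum_transProb t) hpos
    (h.stepDist_transProb t) (h'.stepDist_transProb t) (by simp [mass]) (by simp [mass])
  exact Subtype.ext (Measure.ext_of_singleton (congrFun singletons))

theorem IsEquilibrium.singleton_ne_zero {t : ℝ≥0} (hpos : ∀ x y, Q.transProb t x y ≠ 0)
    {π : ProbabilityMeasure S} (h : Q.IsEquilibrium π) (y : S) : (π : Measure S) {y} ≠ 0 := by
  intro hy
  have flow := congrFun (h.stepDist_transProb t) y
  simp only [hy, stepDist, ENNReal.tsum_eq_zero, mul_eq_zero, hpos, or_false] at flow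
  simpa [flow] using tsum_measure_singleton (π : Measure S)

end RateMatrix

/-! ### Return times -/

section Excursions

variable {S : Type*}

/-- The trajectories that do not visit `x` at the times `1, …, k`. -/
def avoiding (x : S) (k : ℕ) : Set (ℕ → S) := {u | ∀ i < k, u (i + 1) ≠ x}

theorem seqCons_mem_avoiding_succ {x y : S} {k : ℕ} {u : ℕ → S} :
    seqCons y u ∈ avoiding x (k + 1) ↔ u 0 ≠ x ∧ u ∈ avoiding x k :=
  Nat.forall_lt_succ_left' (p := fun i _ => u i ≠ x)

variable [MeasurableSpace S] [DiscreteMeasurableSpace S]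

theorem measurableSet_avoiding (x : S) (k : ℕ) : MeasurableSet (avoiding x k) := by
  simp only [avoiding, Set.ofPred_forall]
  have eval : ∀ i, Measurable fun u : ℕ → S => u (i + 1) := fun i => measurable_pi_apply (i + 1)
  exact .iInter fun i => .iInter fun _ => eval i (measurableSet_singleton x).compl

theorem measurable_indicator_avoiding (x : S) (f : S → ℝ≥0∞) (k : ℕ) :
    Measurable ((avoiding x k).indicator fun u => f (u k)) :=
  ((Measurable.of_discrete (f := f)).comp (measurable_pi_apply k)).indicator
    (measurableSet_avoiding x k)

variable (κ : Kernel S S) [IsMarkovKernel κ]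

theorem ae_markovLaw_dirac_eval_zero (y : S) :
    ∀ᵐ u ∂markovLaw κ (Measure.dirac y), u 0 = y := by
  have eval : Measurable fun u : ℕ → S => u 0 := measurable_pi_apply 0
  refine ae_of_ae_map (p := (· = y)) eval.aemeasurable ?_
  rw [map_eval_zero_markovLaw, ae_dirac_eq]
  rfl

/-- The mean, for the chain with kernel `κ` started from `y`, of the reward `f` collected at time
`k` if `x` has been avoided at the times `1, …, k`. -/
def excursionMean (x : S) (f : S → ℝ≥0∞) (k : ℕ) (y : S) : ℝ≥0∞ :=
  ∫⁻ u, (avoiding x k).indicator (fun u => f (u k)) u ∂markovLaw κ (Measure.dirac y)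

theorem excursionMean_zero (x : S) (f : S → ℝ≥0∞) (y : S) : excursionMean κ x f 0 y = f y := by
  rw [excursionMean, lintegral_congr_ae (g := fun _ => f y)]
  · simp
  · filter_upwards [ae_markovLaw_dirac_eval_zero κ y] with u hu
    simp [avoiding, hu]

open Classical in
theorem excursionMean_succ [Countable S] (x : S) (f : S → ℝ≥0∞) (k : ℕ) (y : S) :
    excursionMean κ x f (k + 1) y =
      ∑' z, κ y {z} * if z = x then 0 else excursionMean κ x f k z := by
  rw [excursionMean, lintegral_markovLaw_dirac κ y (measurable_indicator_avoiding x f (k + 1)),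
    lintegral_countable']
  refine tsum_congr fun z => ?_
  rw [mul_comm]
  congr 1
  split_ifs with hz
  · refine (lintegral_congr_ae ?_).trans lintegral_zero
    filter_upwards [ae_markovLaw_dirac_eval_zero κ z] with u hu
    exact Set.indicator_of_notMem (fun h => (seqCons_mem_avoiding_succ.1 h).1 (hu.trans hz)) _
  · refine lintegral_congr_ae ?_
    filter_upwards [ae_markovLaw_dirac_eval_zero κ z] with u hu
    simp only [Set.indicator, seqCons_mem_avoiding_succ, hu, hz, ne_eq, not_false_eq_true,
      true_and, seqCons_succ]

-- The mass not yet collected, `∑' y, m y * excursionMean κ x f k y`, decreases at step `k` by at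
-- least the `k`-th term of the left-hand side.
theorem mul_tsum_excursionMean_le [Countable S] {m : S → ℝ≥0∞}
    (hm : stepDist (fun y z => κ y {z}) m ≤ m) (x : S) (f : S → ℝ≥0∞) :
    m x * ∑' k, excursionMean κ x f k x ≤ ∑' y, m y * f y := by
  classical
  let left : ℕ → ℝ≥0∞ := fun k => ∑' y, m y * excursionMean κ x f k y
  have step : ∀ k, m x * excursionMean κ x f k x + left (k + 1) ≤ left k := by
    intro k
    have next : left (k + 1) ≤ ∑' z, if z = x then 0 else m z * excursionMean κ x f k z := by
      simp only [left, excursionMean_succ, ← ENNReal.tsum_mul_left]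
      rw [ENNReal.tsum_comm]
      refine ENNReal.tsum_le_tsum fun z => ?_
      simp_rw [← mul_assoc]
      rw [ENNReal.tsum_mul_right]
      refine (mul_le_mul_left (hm z) _).trans_eq ?_
      split_ifs <;> simp
    refine (add_le_add_right next _).trans_eq ?_
    exact (ENNReal.tsum_eq_add_tsum_ite (f := fun z => m z * excursionMean κ x f k z) x).symm
  have collected : ∀ n,
      ∑ k ∈ Finset.range n, m x * excursionMean κ x f k x + left n ≤ ∑' y, m y * f y := by
    intro n
    induction n with
    | zero => simp [left, excursionMean_zero]
    | succ n ih =>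
      rw [Finset.sum_range_succ, add_assoc]
      exact (add_le_add_right (step n) _).trans ih
  rw [← ENNReal.tsum_mul_left, ENNReal.tsum_eq_iSup_nat]
  exact iSup_le fun n => le_self_add.trans (collected n)

end Excursions

theorem ae_clockLaw_pos : ∀ᵐ ξ ∂clockLaw, ∀ n, 0 < ξ n := by
  refine ae_all_iff.2 fun n => ?_
  exact (measurePreserving_eval_infinitePi (fun _ : ℕ => expMeasure 1) n).quasiMeasurePreserving.ae
    (ae_expMeasure_pos one_pos)

theorem lintegral_clockLaw_ofReal (n : ℕ) : ∫⁻ ξ, ENNReal.ofReal (ξ n) ∂clockLaw = 1 := by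
  have h := (measurePreserving_eval_infinitePi (fun _ : ℕ => expMeasure 1) n).lintegral_comp
    ENNReal.measurable_ofReal
  simpa [lintegral_ofReal_expMeasure] using h

namespace RateMatrix

variable {S : Type*} (Q : RateMatrix S)

open Classical in
theorem returnTime_le (x : S) {ω : Path S} (hpos : ∀ n, 0 < ω.2 n)
    (hω : ∑' n, Q.holding n ω = ∞) :
    Q.returnTime x ω ≤ ∑' k, if ω.1 ∈ avoiding x k then Q.holding k ω else 0 := by
  by_cases hex : ∃ n, ω.1 (n + 1) = x
  · set n := Nat.find hex
    have before : Q.jumpTime (n + 1) ω ≤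
        ∑' k, if ω.1 ∈ avoiding x k then Q.holding k ω else 0 := by
      refine le_trans (Finset.sum_congr rfl fun k hk => ?_).le
        (ENNReal.sum_le_tsum (Finset.range (n + 1)))
      exact (if_pos fun i hi => Nat.find_min hex
        (hi.trans_le (Finset.mem_range_succ_iff.1 hk))).symm
    refine le_trans ?_ before
    by_cases hfin : Q.jumpTime (n + 1) ω = ∞
    · exact hfin ▸ le_top
    lift Q.jumpTime (n + 1) ω to ℝ≥0 using hfin with t ht
    refine (iInf_le _ t).trans (iInf₂_le ?_ ?_)
    · exact (Q.jumpTime_mono ω (Nat.le_add_left 1 n)).trans_eq ht.symm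
    · refine (Q.state_eq_some_iff t ω x).2 ⟨n + 1, ht.ge, ?_, Nat.find_spec hex⟩
      rw [jumpTime, Finset.sum_range_succ, ← jumpTime, ← ht]
      exact ENNReal.lt_add_right ENNReal.coe_ne_top (by simp [holding, hpos])
  · have never : ∀ k, ω.1 ∈ avoiding x k := fun k i _ h => hex ⟨i, h⟩
    simp only [never, if_true, hω, le_top]

variable [MeasurableSpace S] [DiscreteMeasurableSpace S]

open Classical in
theorem lintegral_holding_avoiding (x : S) (k : ℕ) (y : S) :
    ∫⁻ ω, (if ω.1 ∈ avoiding x k then Q.holding k ω else 0) ∂Q.lawFrom y =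
      excursionMean Q.jumpKernel x (fun z => (Q.exitRate z : ℝ≥0∞)⁻¹) k y := by
  have factor : ∀ ω : Path S, (if ω.1 ∈ avoiding x k then Q.holding k ω else 0) =
      (avoiding x k).indicator (fun u => (Q.exitRate (u k) : ℝ≥0∞)⁻¹) ω.1 *
        ENNReal.ofReal (ω.2 k) := fun ω => by
    by_cases h : ω.1 ∈ avoiding x k <;> simp [h, holding, ENNReal.div_eq_inv_mul]
  simp_rw [factor]
  rw [lawFrom, law_eq_prod, lintegral_prod_mul (g := fun ξ : ℕ → ℝ => ENNReal.ofReal (ξ k))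
    (measurable_indicator_avoiding x (fun z => (Q.exitRate z : ℝ≥0∞)⁻¹) k).aemeasurable
    (measurable_pi_apply k).ennreal_ofReal.aemeasurable, lintegral_clockLaw_ofReal, mul_one]
  rfl

variable {Q} {p : S → ℝ≥0∞}

theorem IsBalanced.stepDist_jumpKernel (hp : Q.IsBalanced p) :
    stepDist (fun y z => Q.jumpKernel y {z}) (fun y => p y * Q.exitRate y) =
      fun y => p y * Q.exitRate y := by
  ext z
  simp only [stepDist, mul_assoc, exitRate_mul_jumpKernel_singleton]
  exact hp z

variable [Countable S]

theorem IsBalanced.mul_lintegral_returnTime_le (hp : Q.IsBalanced p) (hQ : Q.IsNonexplosive)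
    (x : S) : p x * Q.exitRate x * ∫⁻ ω, Q.returnTime x ω ∂Q.lawFrom x ≤ ∑' y, p y := by
  classical
  have clocks : ∀ᵐ ω ∂Q.lawFrom x, ∀ n, 0 < ω.2 n :=
    Measure.quasiMeasurePreserving_snd.ae ae_clockLaw_pos
  have bound : ∀ᵐ ω ∂Q.lawFrom x, Q.returnTime x ω ≤
      ∑' k, if ω.1 ∈ avoiding x k then Q.holding k ω else 0 := by
    filter_upwards [hQ x, clocks] with ω hω hpos using Q.returnTime_le x hpos hω
  calc p x * Q.exitRate x * ∫⁻ ω, Q.returnTime x ω ∂Q.lawFrom x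
      ≤ p x * Q.exitRate x *
          ∑' k, excursionMean Q.jumpKernel x (fun z => (Q.exitRate z : ℝ≥0∞)⁻¹) k x := by
        gcongr
        refine (lintegral_mono_ae bound).trans_eq ?_
        rw [lintegral_tsum fun k => (Measurable.ite
          (measurable_fst (measurableSet_avoiding x k)) (Q.measurable_holding k)
          measurable_const).aemeasurable]
        simp_rw [lintegral_holding_avoiding]
    _ ≤ ∑' y, p y * Q.exitRate y * (Q.exitRate y : ℝ≥0∞)⁻¹ :=
        mul_tsum_excursionMean_le Q.jumpKernel hp.stepDist_jumpKernel.le x _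
    _ ≤ ∑' y, p y := ENNReal.tsum_le_tsum fun y => by
        rw [mul_assoc]
        exact mul_le_of_le_one_right' (ENNReal.mul_inv_le_one _)

theorem IsBalanced.isPositiveRecurrent (hp : Q.IsBalanced p) (hQ : Q.IsNonexplosive)
    (hpos : ∀ x, p x ≠ 0) (hfin : ∑' x, p x ≠ ∞) : Q.IsPositiveRecurrent := by
  refine fun x => or_iff_not_imp_left.2 fun hx => lt_top_iff_ne_top.2 fun htop => hfin ?_
  have h := hp.mul_lintegral_returnTime_le hQ x
  rwa [htop, ENNReal.mul_top (mul_ne_zero (hpos x) (by exact_mod_cast hx)), top_le_iff] at h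

end RateMatrix

/-! ### Invariant distributions from a drift condition -/

section InvariantDistribution

open Filter Topology

section Cesaro

variable {S : Type*} {K : S → S → ℝ≥0∞} {p : S → ℝ≥0∞}

theorem tsum_stepDist_mul (K : S → S → ℝ≥0∞) (p w : S → ℝ≥0∞) :
    ∑' y, stepDist K p y * w y = ∑' x, p x * ∑' y, K x y * w y := by
  simp_rw [stepDist, ← ENNReal.tsum_mul_right, ← ENNReal.tsum_mul_left]
  rw [ENNReal.tsum_comm]
  simp_rw [mul_assoc]

theorem IsStochasticMatrix.tsum_iterate_stepDist (hK : IsStochasticMatrix K) (p : S → ℝ≥0∞)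
    (n : ℕ) : ∑' x, (stepDist K)^[n] p x = ∑' x, p x := by
  induction n with
  | zero => rfl
  | succ n ih => rw [Function.iterate_succ_apply', hK.tsum_stepDist, ih]

theorem tsum_stepDist_mul_add_le (hp : ∑' x, p x = 1) {V g : S → ℝ≥0∞}
    {c : ℝ≥0∞} (hdrift : ∀ x, ∑' y, K x y * V y + g x ≤ V x + c) :
    ∑' x, stepDist K p x * V x + ∑' x, p x * g x ≤ ∑' x, p x * V x + c :=
  calc ∑' x, stepDist K p x * V x + ∑' x, p x * g x
      = ∑' x, p x * (∑' y, K x y * V y + g x) := by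
        simp_rw [tsum_stepDist_mul, mul_add, ENNReal.tsum_add]
    _ ≤ ∑' x, p x * (V x + c) := ENNReal.tsum_le_tsum fun x => mul_le_mul_right (hdrift x) _
    _ = ∑' x, p x * V x + c := by
        simp_rw [mul_add, ENNReal.tsum_add, ENNReal.tsum_mul_right, hp, one_mul]

theorem IsStochasticMatrix.sum_iterate_stepDist_mul_le (hK : IsStochasticMatrix K)
    (hp : ∑' x, p x = 1) {V g : S → ℝ≥0∞} {c : ℝ≥0∞}
    (hdrift : ∀ x, ∑' y, K x y * V y + g x ≤ V x + c) (n : ℕ) :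
    ∑' x, (stepDist K)^[n] p x * V x + ∑ k ∈ Finset.range n, ∑' x, (stepDist K)^[k] p x * g x ≤
      ∑' x, p x * V x + n * c := by
  induction n with
  | zero => simp
  | succ n ih =>
    have step := tsum_stepDist_mul_add_le ((hK.tsum_iterate_stepDist p n).trans hp) hdrift
    rw [← Function.iterate_succ_apply' (stepDist K)] at step
    rw [Finset.sum_range_succ, add_left_comm, add_comm]
    calc _ = ∑' x, (stepDist K)^[n + 1] p x * V x + ∑' x, (stepDist K)^[n] p x * g x +
          ∑ k ∈ Finset.range n, ∑' x, (stepDist K)^[k] p x * g x := by ring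
      _ ≤ ∑' x, (stepDist K)^[n] p x * V x + c +
          ∑ k ∈ Finset.range n, ∑' x, (stepDist K)^[k] p x * g x := by gcongr
      _ = (∑' x, (stepDist K)^[n] p x * V x +
          ∑ k ∈ Finset.range n, ∑' x, (stepDist K)^[k] p x * g x) + c := by ring
      _ ≤ ∑' x, p x * V x + n * c + c := by gcongr
      _ = ∑' x, p x * V x + (n + 1 : ℕ) * c := by push_cast; ring

/-- The Cesàro average of the distributions, at the times `0, …, n`, of the chain with transition
matrix `K` and initial distribution `p`. -/
def cesaroDist (K : S → S → ℝ≥0∞) (p : S → ℝ≥0∞) (n : ℕ) (y : S) : ℝ≥0∞ :=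
  ((n + 1 : ℕ) : ℝ≥0∞)⁻¹ * ∑ k ∈ Finset.range (n + 1), (stepDist K)^[k] p y

theorem inv_natCast_succ_mul_self (n : ℕ) : ((n + 1 : ℕ) : ℝ≥0∞)⁻¹ * (n + 1 : ℕ) = 1 :=
  ENNReal.inv_mul_cancel (by simp) (ENNReal.natCast_ne_top _)

theorem tsum_cesaroDist_mul (K : S → S → ℝ≥0∞) (p w : S → ℝ≥0∞) (n : ℕ) :
    ∑' x, cesaroDist K p n x * w x =
      ((n + 1 : ℕ) : ℝ≥0∞)⁻¹ * ∑ k ∈ Finset.range (n + 1), ∑' x, (stepDist K)^[k] p x * w x := by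
  simp only [cesaroDist, mul_assoc, ENNReal.tsum_mul_left, Finset.sum_mul]
  rw [Summable.tsum_finsetSum fun _ _ => ENNReal.summable]

theorem IsStochasticMatrix.tsum_cesaroDist (hK : IsStochasticMatrix K) (p : S → ℝ≥0∞) (n : ℕ) :
    ∑' x, cesaroDist K p n x = ∑' x, p x := by
  have h := tsum_cesaroDist_mul K p 1 n
  simp only [Pi.one_apply, mul_one, hK.tsum_iterate_stepDist, Finset.sum_const, Finset.card_range,
    nsmul_eq_mul] at h
  rw [h, ← mul_assoc, inv_natCast_succ_mul_self, one_mul]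

theorem IsStochasticMatrix.tsum_cesaroDist_mul_le (hK : IsStochasticMatrix K)
    (hp : ∑' x, p x = 1) {V g : S → ℝ≥0∞} {c : ℝ≥0∞}
    (hdrift : ∀ x, ∑' y, K x y * V y + g x ≤ V x + c) (n : ℕ) :
    ∑' x, cesaroDist K p n x * g x ≤ ((n + 1 : ℕ) : ℝ≥0∞)⁻¹ * ∑' x, p x * V x + c :=
  calc ∑' x, cesaroDist K p n x * g x
      ≤ ((n + 1 : ℕ) : ℝ≥0∞)⁻¹ * (∑' x, p x * V x + (n + 1 : ℕ) * c) := by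
        rw [tsum_cesaroDist_mul]
        gcongr
        exact le_add_self.trans (hK.sum_iterate_stepDist_mul_le hp hdrift (n + 1))
    _ = ((n + 1 : ℕ) : ℝ≥0∞)⁻¹ * ∑' x, p x * V x + c := by
        rw [mul_add, ← mul_assoc, inv_natCast_succ_mul_self, one_mul]

theorem IsStochasticMatrix.stepDist_cesaroDist_le (hK : IsStochasticMatrix K)
    (hp : ∑' x, p x = 1) (n : ℕ) (y : S) :
    stepDist K (cesaroDist K p n) y ≤ cesaroDist K p n y + ((n + 1 : ℕ) : ℝ≥0∞)⁻¹ := by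
  let u : ℕ → ℝ≥0∞ := fun k => (stepDist K)^[k] p y
  have last : u (n + 1) ≤ 1 :=
    (ENNReal.le_tsum y).trans_eq ((hK.tsum_iterate_stepDist p (n + 1)).trans hp)
  calc stepDist K (cesaroDist K p n) y
      = ((n + 1 : ℕ) : ℝ≥0∞)⁻¹ * ∑ k ∈ Finset.range (n + 1), u (k + 1) := by
        simp only [stepDist, tsum_cesaroDist_mul, u, Function.iterate_succ_apply']
    _ ≤ ((n + 1 : ℕ) : ℝ≥0∞)⁻¹ * (∑ k ∈ Finset.range (n + 1), u k + 1) := by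
        refine mul_le_mul_right ?_ _
        calc ∑ k ∈ Finset.range (n + 1), u (k + 1)
            ≤ ∑ k ∈ Finset.range (n + 1), u (k + 1) + u 0 := le_self_add
          _ = ∑ k ∈ Finset.range (n + 1), u k + u (n + 1) := by
              rw [← Finset.sum_range_succ', Finset.sum_range_succ]
          _ ≤ ∑ k ∈ Finset.range (n + 1), u k + 1 := by gcongr
    _ = cesaroDist K p n y + ((n + 1 : ℕ) : ℝ≥0∞)⁻¹ := by rw [mul_add, mul_one, cesaroDist]

end Cesaro

section Limits

theorem tsum_le_sum_add_inv_mul_tsum {S : Type*} (a : S → ℝ≥0∞) {g : S → ℝ≥0∞} {F : Finset S}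
    {r : ℝ≥0∞} (hr : r ≠ 0) (hr' : r ≠ ∞) (hF : ∀ x ∉ F, r ≤ g x) :
    ∑' x, a x ≤ ∑ x ∈ F, a x + r⁻¹ * ∑' x, a x * g x := by
  classical
  rw [← Finset.tsum_subtype' F a, tsum_subtype (F : Set S) a, ← ENNReal.tsum_mul_left,
    ← ENNReal.tsum_add]
  refine ENNReal.tsum_le_tsum fun x => ?_
  by_cases hx : x ∈ F
  · rw [Set.indicator_of_mem (Finset.mem_coe.2 hx)]
    exact le_self_add
  · rw [Set.indicator_of_notMem (mt Finset.mem_coe.1 hx), zero_add, mul_left_comm]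
    refine le_mul_of_one_le_right' ?_
    rw [← ENNReal.inv_mul_cancel hr hr']
    exact mul_le_mul_right (hF x hx) _

variable {S ι : Type*} {l : Filter ι} [l.NeBot] {a : ι → S → ℝ≥0∞} {p : S → ℝ≥0∞}

theorem tsum_mul_le_of_tendsto (ha : Tendsto a l (𝓝 p)) {w : S → ℝ≥0∞} (hw : ∀ x, w x ≠ ∞)
    {b : ι → ℝ≥0∞} {c : ℝ≥0∞} (hb : Tendsto b l (𝓝 c)) (hab : ∀ i, ∑' x, a i x * w x ≤ b i) :
    ∑' x, p x * w x ≤ c := by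
  rw [ENNReal.tsum_eq_iSup_sum]
  refine iSup_le fun F => le_of_tendsto_of_tendsto'
    (tendsto_finsetSum F fun x _ => ?_) hb fun i => (ENNReal.sum_le_tsum F).trans (hab i)
  exact ENNReal.Tendsto.mul_const (tendsto_pi_nhds.1 ha x) (Or.inr (hw x))

theorem one_le_tsum_of_tendsto (ha : Tendsto a l (𝓝 p)) (hmass : ∀ i, ∑' x, a i x = 1)
    {g : S → ℝ≥0∞} (hg : ∀ r : ℝ≥0, {x | g x ≤ r}.Finite) {c : ℝ≥0∞} (hc : c ≠ ∞)
    (hag : ∀ i, ∑' x, a i x * g x ≤ c) : 1 ≤ ∑' x, p x := by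
  have tight : ∀ n : ℕ, 1 ≤ ∑' x, p x + ((n + 1 : ℕ) : ℝ≥0∞)⁻¹ * c := by
    intro n
    have hF : ∀ x ∉ (hg (n + 1 : ℕ)).toFinset, ((n + 1 : ℕ) : ℝ≥0∞) ≤ g x := fun x hx => by
      rw [Set.Finite.mem_toFinset] at hx
      exact (not_le.1 hx).le
    set F := (hg (n + 1 : ℕ)).toFinset
    have captured : ∀ i, 1 ≤ ∑ x ∈ F, a i x + ((n + 1 : ℕ) : ℝ≥0∞)⁻¹ * c := fun i => by
      rw [← hmass i]
      refine (tsum_le_sum_add_inv_mul_tsum (a i) (by simp) (ENNReal.natCast_ne_top _) hF).trans ?_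
      gcongr
      exact hag i
    refine (ge_of_tendsto' ((tendsto_finsetSum F fun x _ =>
      tendsto_pi_nhds.1 ha x).add_const _) captured).trans ?_
    gcongr
    exact ENNReal.sum_le_tsum F
  have vanish : Tendsto (fun n : ℕ => ((n + 1 : ℕ) : ℝ≥0∞)⁻¹ * c) atTop (𝓝 0) := by
    simpa using ENNReal.Tendsto.mul_const
      (ENNReal.tendsto_inv_nat_nhds_zero.comp (tendsto_add_atTop_nat 1)) (Or.inr hc)
  simpa using ge_of_tendsto' (vanish.const_add (∑' x, p x)) tight

end Limits

-- Foster's criterion. The drift condition keeps the Cesàro averages tight, so that none of the mass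
-- is lost in a limit along an ultrafilter; the limit is sub-invariant, hence invariant.
theorem IsStochasticMatrix.exists_stepDist_eq_of_drift {S : Type*} {K : S → S → ℝ≥0∞}
    (hK : IsStochasticMatrix K) {V g : S → ℝ≥0∞} {c : ℝ≥0∞} (hc : c ≠ ∞) (x₀ : S) (hV : V x₀ ≠ ∞)
    (hdrift : ∀ x, ∑' y, K x y * V y + g x ≤ V x + c) (hg : ∀ r : ℝ≥0, {x | g x ≤ r}.Finite)
    (hg' : ∀ x, g x ≠ ∞) :
    ∃ p : S → ℝ≥0∞, ∑' x, p x = 1 ∧ stepDist K p = p ∧ ∑' x, p x * g x ≤ c := by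
  classical
  set δ : S → ℝ≥0∞ := Pi.single x₀ 1
  have hδ : ∑' x, δ x = 1 := tsum_pi_single x₀ 1
  have hδV : ∑' x, δ x * V x = V x₀ := by
    rw [tsum_eq_single x₀ fun x hx => by simp [δ, hx]]
    simp [δ]
  set a : ℕ → S → ℝ≥0∞ := cesaroDist K δ
  have mass : ∀ n, ∑' x, a n x = 1 := fun n => (hK.tsum_cesaroDist δ n).trans hδ
  have inv : Tendsto (fun n : ℕ => ((n + 1 : ℕ) : ℝ≥0∞)⁻¹) (hyperfilter ℕ) (𝓝 0) :=
    (ENNReal.tendsto_inv_nat_nhds_zero.comp (tendsto_add_atTop_nat 1)).mono_left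
      Nat.hyperfilter_le_atTop
  have drift : ∀ n : ℕ, ∑' x, a n x * g x ≤ ((n + 1 : ℕ) : ℝ≥0∞)⁻¹ * V x₀ + c := fun n =>
    hδV ▸ hK.tsum_cesaroDist_mul_le hδ hdrift n
  obtain ⟨p, ha⟩ : ∃ p, Tendsto a (hyperfilter ℕ) (𝓝 p) :=
    ⟨_, ((hyperfilter ℕ).map a).le_nhds_lim⟩
  have mass_le : ∑' x, p x ≤ 1 := by
    simpa using tsum_mul_le_of_tendsto ha (w := 1) (by simp) tendsto_const_nhds
      fun n => by simpa using (mass n).le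
  have mass_ge : 1 ≤ ∑' x, p x := by
    refine one_le_tsum_of_tendsto ha mass hg (ENNReal.add_ne_top.2 ⟨hV, hc⟩) fun n => ?_
    refine (drift n).trans (add_le_add_left (mul_le_of_le_one_left' ?_) c)
    exact ENNReal.inv_le_one.2 (by exact_mod_cast Nat.le_add_left 1 n)
  have subinvariant : stepDist K p ≤ p := fun y =>
    tsum_mul_le_of_tendsto ha (fun x => hK.ne_top x y)
      (by simpa using (tendsto_pi_nhds.1 ha y).add inv) fun n => hK.stepDist_cesaroDist_le hδ n y
  refine ⟨p, le_antisymm mass_le mass_ge, hK.stepDist_eq_of_le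
    (ne_top_of_le_ne_top ENNReal.one_ne_top mass_le) subinvariant, ?_⟩
  refine tsum_mul_le_of_tendsto ha hg' ?_ drift
  simpa using (ENNReal.Tendsto.mul_const inv (Or.inr hV)).add_const c

end InvariantDistribution

/-! ### Uniformization -/

theorem exists_probabilityMeasure_singleton_eq {S : Type*} [MeasurableSpace S]
    [MeasurableSingletonClass S] {p : S → ℝ≥0∞} (hp : ∑' x, p x = 1) :
    ∃ π : ProbabilityMeasure S, (fun x => (π : Measure S) {x}) = p := by
  let P : PMF S := ⟨p, hp ▸ ENNReal.summable.hasSum⟩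
  exact ⟨⟨P.toMeasure, inferInstance⟩, funext fun x =>
    P.toMeasure_apply_singleton x (measurableSet_singleton x)⟩

namespace RateMatrix

variable {S : Type*} (Q : RateMatrix S) {B : ℝ≥0}

open Classical in
/-- The uniformization of `Q` at rate `B`: run at the times of a Poisson process of rate `B`, the
discrete-time chain with this transition matrix is the chain with rates `Q`, provided that `B`
bounds the exit rates. -/
def uniformized (B : ℝ≥0) (x y : S) : ℝ≥0∞ :=
  (if y = x then 1 - (B : ℝ≥0∞)⁻¹ * Q.exitRate x else 0) + (B : ℝ≥0∞)⁻¹ * Q.rate x y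

theorem tsum_uniformized_mul (x : S) (w : S → ℝ≥0∞) :
    ∑' y, Q.uniformized B x y * w y =
      (1 - (B : ℝ≥0∞)⁻¹ * Q.exitRate x) * w x + (B : ℝ≥0∞)⁻¹ * ∑' y, Q.rate x y * w y := by
  simp only [uniformized, add_mul, ENNReal.tsum_add, mul_assoc, ENNReal.tsum_mul_left]
  congr 1
  rw [tsum_eq_single x fun y hy => by rw [if_neg hy, zero_mul], if_pos rfl]

theorem stepDist_uniformized (p : S → ℝ≥0∞) (y : S) :
    stepDist (Q.uniformized B) p y =
      p y * (1 - (B : ℝ≥0∞)⁻¹ * Q.exitRate y) + (B : ℝ≥0∞)⁻¹ * ∑' x, p x * Q.rate x y := by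
  simp only [stepDist, uniformized, mul_add, ENNReal.tsum_add, mul_left_comm _ (B : ℝ≥0∞)⁻¹,
    ENNReal.tsum_mul_left]
  congr 1
  rw [tsum_eq_single y fun x hx => by rw [if_neg hx.symm, mul_zero], if_pos rfl]

variable {Q}

theorem one_sub_inv_mul_exitRate_add {x : S} (hB : Q.exitRate x ≤ B) :
    1 - (B : ℝ≥0∞)⁻¹ * Q.exitRate x + (B : ℝ≥0∞)⁻¹ * Q.exitRate x = 1 :=
  tsub_add_cancel_of_le <|
    (mul_le_mul_right (ENNReal.coe_le_coe.2 hB) _).trans (ENNReal.inv_mul_le_one _)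

theorem tsum_mul_exitRate_ne_top (hB : ∀ x, Q.exitRate x ≤ B) {p : S → ℝ≥0∞}
    (hp : ∑' x, p x ≠ ∞) : ∑' x, p x * Q.exitRate x ≠ ∞ := by
  have bound : ∑' x, p x * Q.exitRate x ≤ ∑' x, p x * (B : ℝ≥0∞) :=
    ENNReal.tsum_le_tsum fun x => mul_le_mul_right (ENNReal.coe_le_coe.2 (hB x)) (p x)
  rw [ENNReal.tsum_mul_right] at bound
  exact ne_top_of_le_ne_top (ENNReal.mul_ne_top hp ENNReal.coe_ne_top) bound

theorem isStochasticMatrix_uniformized (hB : ∀ x, Q.exitRate x ≤ B) :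
    IsStochasticMatrix (Q.uniformized B) := fun x => by
  simpa [Q.tsum_rate_eq, one_sub_inv_mul_exitRate_add (hB x)] using
    Q.tsum_uniformized_mul (B := B) x 1

theorem isBalanced_of_stepDist_uniformized (hB₀ : B ≠ 0) (hB : ∀ x, Q.exitRate x ≤ B)
    {p : S → ℝ≥0∞} (hp : stepDist (Q.uniformized B) p = p) (hfin : ∀ x, p x ≠ ∞) :
    Q.IsBalanced p := fun y => by
  have stay : p y * (1 - (B : ℝ≥0∞)⁻¹ * Q.exitRate y) ≠ ∞ :=
    ENNReal.mul_ne_top (hfin y) (ne_top_of_le_ne_top ENNReal.one_ne_top tsub_le_self)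
  have balance : p y * (1 - (B : ℝ≥0∞)⁻¹ * Q.exitRate y) + (B : ℝ≥0∞)⁻¹ * ∑' x, p x * Q.rate x y =
      p y * (1 - (B : ℝ≥0∞)⁻¹ * Q.exitRate y) + (B : ℝ≥0∞)⁻¹ * (p y * Q.exitRate y) := by
    rw [← stepDist_uniformized, hp, mul_left_comm, ← mul_add, one_sub_inv_mul_exitRate_add (hB y),
      mul_one]
  exact (ENNReal.mul_right_inj (by simp) (by simpa using hB₀)).1
    ((ENNReal.add_right_inj stay).1 balance)

theorem uniformized_drift_le {x : S} (hB : Q.exitRate x ≤ B) {V f : S → ℝ≥0∞} {C : ℝ≥0∞}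
    (hdrift : ∑' y, Q.rate x y * V y + f x ≤ Q.exitRate x * V x + C) :
    ∑' y, Q.uniformized B x y * V y + (B : ℝ≥0∞)⁻¹ * f x ≤ V x + (B : ℝ≥0∞)⁻¹ * C :=
  calc ∑' y, Q.uniformized B x y * V y + (B : ℝ≥0∞)⁻¹ * f x
      = (1 - (B : ℝ≥0∞)⁻¹ * Q.exitRate x) * V x +
          (B : ℝ≥0∞)⁻¹ * (∑' y, Q.rate x y * V y + f x) := by
        rw [tsum_uniformized_mul, mul_add, add_assoc]
    _ ≤ (1 - (B : ℝ≥0∞)⁻¹ * Q.exitRate x) * V x +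
          (B : ℝ≥0∞)⁻¹ * (Q.exitRate x * V x + C) := by gcongr
    _ = (1 - (B : ℝ≥0∞)⁻¹ * Q.exitRate x + (B : ℝ≥0∞)⁻¹ * Q.exitRate x) * V x +
          (B : ℝ≥0∞)⁻¹ * C := by ring
    _ = V x + (B : ℝ≥0∞)⁻¹ * C := by rw [one_sub_inv_mul_exitRate_add hB, one_mul]

theorem exists_isBalanced_of_drift (hB : ∀ x, Q.exitRate x ≤ B) {V f : S → ℝ≥0∞} {C : ℝ≥0∞}
    (hC : C ≠ ∞) (x₀ : S) (hV : V x₀ ≠ ∞)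
    (hdrift : ∀ x, ∑' y, Q.rate x y * V y + f x ≤ Q.exitRate x * V x + C)
    (hf : ∀ r : ℝ≥0, {x | f x ≤ r}.Finite) (hf' : ∀ x, f x ≠ ∞) :
    ∃ p : S → ℝ≥0∞, ∑' x, p x = 1 ∧ Q.IsBalanced p ∧ ∑' x, p x * f x ≤ C := by
  wlog hB₀ : B ≠ 0 generalizing B
  · exact this (B := B + 1) (fun x => (hB x).trans le_self_add) (by positivity)
  have scale : ((B : ℝ≥0∞)⁻¹ ≠ 0) ∧ (B : ℝ≥0∞)⁻¹ ≠ ∞ := ⟨by simp, by simpa using hB₀⟩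
  obtain ⟨p, hp, hinv, hmean⟩ := (isStochasticMatrix_uniformized hB).exists_stepDist_eq_of_drift
    (g := fun x => (B : ℝ≥0∞)⁻¹ * f x) (ENNReal.mul_ne_top scale.2 hC) x₀ hV
    (fun x => uniformized_drift_le (hB x) (hdrift x))
    (fun r => (hf (B * r)).subset fun x hx => by
      rw [Set.mem_ofPred_eq, ENNReal.inv_mul_le_iff (by simpa using hB₀) ENNReal.coe_ne_top] at hx
      simpa using hx)
    (fun x => ENNReal.mul_ne_top scale.2 (hf' x))
  simp only [mul_left_comm _ (B : ℝ≥0∞)⁻¹, ENNReal.tsum_mul_left] at hmean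
  exact ⟨p, hp, isBalanced_of_stepDist_uniformized hB₀ hB hinv
    (ENNReal.ne_top_of_tsum_ne_top (hp ▸ ENNReal.one_ne_top)),
    (ENNReal.mul_le_mul_iff_right scale.1 scale.2).1 hmean⟩

theorem IsEquilibrium.lintegral_state [Countable S] [MeasurableSpace S]
    [DiscreteMeasurableSpace S] {π : ProbabilityMeasure S} (h : Q.IsEquilibrium π)
    (hQ : Q.IsNonexplosive) (F : Option S → ℝ≥0∞) (t : ℝ≥0) :
    ∫⁻ ω, F (Q.state t ω) ∂Q.law (π : Measure S) = ∑' y, (π : Measure S) {y} * F (some y) := by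
  have decompose : ∀ᵐ ω ∂Q.law (π : Measure S), F (Q.state t ω) =
      ∑' y, {ω | Q.state t ω = some y}.indicator (fun _ => F (some y)) ω := by
    filter_upwards [hQ.ae_law π] with ω hω
    obtain ⟨y, hy⟩ := Option.isSome_iff_exists.1 (Q.state_isSome t hω)
    rw [tsum_eq_single y fun z hz => by simp [hy, hz.symm]]
    simp [hy]
  rw [lintegral_congr_ae decompose, lintegral_tsum fun y =>
    (measurable_const.indicator (Q.measurableSet_state t y)).aemeasurable]
  refine tsum_congr fun y => ?_
  rw [lintegral_indicator_const (Q.measurableSet_state t y), h t y, mul_comm]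

end RateMatrix

/-! ### Threshold-based two-choice -/

theorem reflTransGen_of_descent {α : Type*} {r : α → α → Prop} {P : α → Prop} {y : α} (d : α → ℕ)
    (h : ∀ x, P x → x ≠ y → ∃ z, r x z ∧ P z ∧ d z < d x) (x : α) (hx : P x) :
    Relation.ReflTransGen r x y := by
  induction hn : d x using Nat.strong_induction_on generalizing x with
  | _ n ih =>
    by_cases hxy : x = y
    · rw [hxy]
    · obtain ⟨z, hxz, hz, hlt⟩ := h x hx hxy
      exact .head hxz (ih (d z) (hn ▸ hlt) z hz rfl)

theorem finite_mul_sum_natCast_le {ι : Type*} [Fintype ι] {c : ℝ≥0} (hc : 0 < c) (r : ℝ≥0) :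
    {q : ι → ℕ | c * ∑ i, (q i : ℝ≥0) ≤ r}.Finite := by
  classical
  refine (Set.finite_Icc (0 : ι → ℕ) fun _ => ⌊r / c⌋₊).subset fun q hq => ?_
  refine ⟨fun i => Nat.zero_le _, fun i => Nat.le_floor ?_⟩
  rw [le_div_iff₀' hc]
  refine le_trans ?_ hq
  gcongr
  exact Finset.single_le_sum (f := fun i => (q i : ℝ≥0)) (fun _ _ => zero_le) (Finset.mem_univ i)

namespace TTC

variable {N : ℕ}

section Routing

theorem route_le {T : ℝ} (hT : 0 ≤ T) (q : Fin N → ℕ) (h r : Fin N) : q (route T q h r) ≤ q h := by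
  unfold route
  split_ifs with hlt
  · have : (q r : ℝ) ≤ q h := by linarith
    exact_mod_cast this
  · exact le_rfl

theorem sum_joinProb_mul (T : ℝ) (A : Fin N → Finset (Fin N)) (q : Fin N → ℕ) (w : Fin N → ℝ≥0) :
    ∑ i, joinProb T A q i * w i =
      ∑ h, (N : ℝ≥0)⁻¹ * ∑ r ∈ A h, ((A h).card : ℝ≥0)⁻¹ * w (route T q h r) := by
  simp only [joinProb, Finset.sum_mul]
  rw [Finset.sum_comm]
  refine Finset.sum_congr rfl fun h _ => ?_
  simp only [Finset.mul_sum, Finset.sum_mul]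
  rw [Finset.sum_comm]
  refine Finset.sum_congr rfl fun r _ => ?_
  rw [Finset.sum_eq_single (route T q h r) (fun i _ hi => by simp [hi.symm]) (by simp)]
  simp [mul_assoc]

variable {A : Fin N → Finset (Fin N)} (hA : ∀ h, (A h).Nonempty)
include hA

theorem card_ne_zero (h : Fin N) : ((A h).card : ℝ≥0) ≠ 0 := by
  exact_mod_cast (Finset.card_pos.2 (hA h)).ne'

theorem sum_joinProb (hN : 0 < N) (T : ℝ) (q : Fin N → ℕ) : ∑ i, joinProb T A q i = 1 := by
  have hN' : (N : ℝ≥0) ≠ 0 := by exact_mod_cast hN.ne'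
  simpa [card_ne_zero hA, hN'] using sum_joinProb_mul T A q 1

theorem sum_joinProb_mul_queue_le {T : ℝ} (hT : 0 ≤ T) (q : Fin N → ℕ) :
    N * ∑ i, joinProb T A q i * q i ≤ ∑ i, (q i : ℝ≥0) := by
  rw [sum_joinProb_mul T A q fun i => (q i : ℝ≥0), ← Finset.mul_sum, ← mul_assoc]
  refine (mul_le_of_le_one_left' mul_inv_le_one).trans (Finset.sum_le_sum fun h _ => ?_)
  calc ∑ r ∈ A h, ((A h).card : ℝ≥0)⁻¹ * (q (route T q h r) : ℝ≥0)
      ≤ ∑ _r ∈ A h, ((A h).card : ℝ≥0)⁻¹ * (q h : ℝ≥0) := by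
        gcongr
        exact route_le hT q h _
    _ = q h := by
        rw [Finset.sum_const, nsmul_eq_mul, mul_inv_cancel_left₀ (card_ne_zero hA h)]

theorem joinProb_ne_zero_of_minimal {T : ℝ} (hT : 0 ≤ T) {q : Fin N → ℕ} {i : Fin N}
    (hi : ∀ j, q i ≤ q j) : joinProb T A q i ≠ 0 := by
  have stays : ∀ r, route T q i r = i := fun r => by
    have : (q i : ℝ) ≤ q r := by exact_mod_cast hi r
    exact if_neg (by linarith)
  intro h₀
  have hN' : N ≠ 0 := i.pos.ne'
  have := Finset.sum_eq_zero_iff.1 h₀ i (Finset.mem_univ i)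
  simp [stays, hN', (hA i).ne_empty] at this

end Routing

section Rates

theorem tsum_rate_mul (lam : ℝ≥0) (T : ℝ) (A : Fin N → Finset (Fin N)) (q : Fin N → ℕ)
    (F : (Fin N → ℕ) → ℝ≥0) :
    ∑' q', ((chain N lam T A).rate q q' : ℝ≥0∞) * F q' =
      ((∑ i, N * lam * joinProb T A q i * F (Function.update q i (q i + 1)) +
        ∑ i, if 0 < q i then F (Function.update q i (q i - 1)) else 0 : ℝ≥0) : ℝ≥0∞) := by
  simp only [chain, rate, ENNReal.coe_add, ENNReal.ofNNReal_finsetSum, add_mul, Finset.sum_mul]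
  rw [ENNReal.tsum_add, Summable.tsum_finsetSum fun _ _ => ENNReal.summable,
    Summable.tsum_finsetSum fun _ _ => ENNReal.summable]
  congr 1
  · refine Finset.sum_congr rfl fun i _ => ?_
    rw [tsum_eq_single (Function.update q i (q i + 1)) fun q' hq' => by simp [hq']]
    simp
  · refine Finset.sum_congr rfl fun i _ => ?_
    rw [tsum_eq_single (Function.update q i (q i - 1)) fun q' hq' => by simp [hq']]
    split_ifs <;> simp_all

theorem rate_departure_ne_zero (lam : ℝ≥0) (T : ℝ) (A : Fin N → Finset (Fin N)) {q : Fin N → ℕ}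
    {i : Fin N} (hi : 0 < q i) :
    (chain N lam T A).rate q (Function.update q i (q i - 1)) ≠ 0 := by
  refine (add_pos_of_nonneg_of_pos zero_le ?_).ne'
  exact Finset.sum_pos' (fun _ _ => zero_le) ⟨i, Finset.mem_univ i, by simp [hi]⟩

variable {lam : ℝ≥0} {A : Fin N → Finset (Fin N)}

theorem rate_arrival_ne_zero (hlam0 : 0 < lam) {T : ℝ} {q : Fin N → ℕ} {i : Fin N}
    (hi : joinProb T A q i ≠ 0) :
    (chain N lam T A).rate q (Function.update q i (q i + 1)) ≠ 0 := by
  have hN : (N : ℝ≥0) ≠ 0 := by exact_mod_cast i.pos.ne'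
  refine (add_pos_of_pos_of_nonneg ?_ zero_le).ne'
  exact Finset.sum_pos' (fun _ _ => zero_le) ⟨i, Finset.mem_univ i, by
    simpa using pos_iff_ne_zero.2 (mul_ne_zero (mul_ne_zero hN hlam0.ne') hi)⟩

theorem exitRate_eq (hN : 0 < N) (lam : ℝ≥0) (T : ℝ) (hA : ∀ h, (A h).Nonempty)
    (q : Fin N → ℕ) :
    (chain N lam T A).exitRate q = N * lam + ∑ i, if 0 < q i then 1 else 0 := by
  have h := tsum_rate_mul lam T A q 1
  simp only [Pi.one_apply, ENNReal.coe_one, mul_one, RateMatrix.tsum_rate_eq] at h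
  rw [ENNReal.coe_inj.1 h, ← Finset.mul_sum, sum_joinProb hA hN, mul_one]

theorem exitRate_le (hN : 0 < N) (lam : ℝ≥0) (T : ℝ) (hA : ∀ h, (A h).Nonempty)
    (q : Fin N → ℕ) : (chain N lam T A).exitRate q ≤ N * lam + N := by
  rw [exitRate_eq hN lam T hA]
  gcongr
  calc ∑ i, (if 0 < q i then 1 else 0 : ℝ≥0) ≤ ∑ _i : Fin N, 1 :=
        Finset.sum_le_sum fun i _ => by split_ifs <;> simp
    _ = N := by simp

end Rates

section Communication

theorem reaches_of_le (lam : ℝ≥0) (T : ℝ) (A : Fin N → Finset (Fin N)) {q y : Fin N → ℕ}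
    (h : y ≤ q) : Relation.ReflTransGen (fun x z => (chain N lam T A).rate x z ≠ 0) q y := by
  refine reflTransGen_of_descent (P := (y ≤ ·)) (fun x => ∑ i, x i) (fun x hx hne => ?_) q h
  obtain ⟨i, hi⟩ := (Pi.lt_def.1 (lt_of_le_of_ne hx hne.symm)).2
  refine ⟨_, rate_departure_ne_zero lam T A (pos_of_gt hi), ?_, Fintype.sum_strictMono ?_⟩
  · exact le_update_iff.2 ⟨Nat.le_sub_one_of_lt hi, fun j _ => hx j⟩
  · exact update_lt_self_iff.2 (Nat.sub_one_lt (pos_of_gt hi).ne')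

variable {lam : ℝ≥0} {T : ℝ} {A : Fin N → Finset (Fin N)}

theorem reaches_const (hN : 0 < N) (hlam0 : 0 < lam) (hT : 0 ≤ T) (hA : ∀ h, (A h).Nonempty)
    {m : ℕ} {q : Fin N → ℕ} (h : q ≤ fun _ => m) :
    Relation.ReflTransGen (fun x z => (chain N lam T A).rate x z ≠ 0) q fun _ => m := by
  have : Nonempty (Fin N) := ⟨⟨0, hN⟩⟩
  refine reflTransGen_of_descent (P := (· ≤ fun _ => m)) (fun x => N * m - ∑ i, x i)
    (fun x hx hne => ?_) q h
  obtain ⟨i, hi⟩ := Finite.exists_min x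
  have him : x i < m := not_le.1 fun hm => hne (le_antisymm hx fun j => hm.trans (hi j))
  have up : Function.update x i (x i + 1) ≤ fun _ => m :=
    update_le_iff.2 ⟨him, fun j _ => hx j⟩
  refine ⟨_, rate_arrival_ne_zero hlam0 (joinProb_ne_zero_of_minimal hA hT hi), up, ?_⟩
  have increase : ∑ j, x j < ∑ j, Function.update x i (x i + 1) j :=
    Fintype.sum_strictMono (lt_update_self_iff.2 (Nat.lt_succ_self (x i)))
  have bound : ∑ j, Function.update x i (x i + 1) j ≤ N * m := by
    simpa using Fintype.sum_mono up
  exact Nat.sub_lt_sub_left (increase.trans_le bound) increase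

theorem reaches (hN : 0 < N) (hlam0 : 0 < lam) (hT : 0 ≤ T) (hA : ∀ h, (A h).Nonempty)
    (x y : Fin N → ℕ) : Relation.ReflTransGen (fun x z => (chain N lam T A).rate x z ≠ 0) x y := by
  obtain ⟨m, hm⟩ := (Set.toFinite (Set.range (x ⊔ y))).bddAbove
  have bound : ∀ i, x i ⊔ y i ≤ m := fun i => hm ⟨i, rfl⟩
  exact (reaches_const hN hlam0 hT hA fun i => le_sup_left.trans (bound i)).trans
    (reaches_of_le lam T A fun i => le_sup_right.trans (bound i))

end Communication

section Drift

/-- The sum of the squares of the queue lengths, which serves as Lyapunov function. -/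
def energy (q : Fin N → ℕ) : ℝ≥0 := ∑ i, (q i : ℝ≥0) ^ 2

theorem energy_update (q : Fin N → ℕ) (i : Fin N) (n : ℕ) :
    energy (Function.update q i n) + (q i : ℝ≥0) ^ 2 = energy q + (n : ℝ≥0) ^ 2 := by
  have others : ∑ j ∈ Finset.univ.erase i, (Function.update q i n j : ℝ≥0) ^ 2 =
      ∑ j ∈ Finset.univ.erase i, (q j : ℝ≥0) ^ 2 :=
    Finset.sum_congr rfl fun j hj => by rw [Function.update_of_ne (Finset.ne_of_mem_erase hj)]
  rw [energy, energy, ← Finset.sum_erase_add _ _ (Finset.mem_univ i), others,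
    Function.update_self, add_right_comm, Finset.sum_erase_add _ _ (Finset.mem_univ i)]

theorem energy_arrival (q : Fin N → ℕ) (i : Fin N) :
    energy (Function.update q i (q i + 1)) = energy q + 1 + 2 * q i := by
  refine add_right_cancel ((energy_update q i (q i + 1)).trans ?_)
  push_cast
  ring

theorem energy_departure {q : Fin N → ℕ} {i : Fin N} (hi : 0 < q i) :
    energy (Function.update q i (q i - 1)) + 2 * q i = energy q + 1 := by
  obtain ⟨n, hn⟩ := Nat.exists_eq_add_one.2 hi
  have h := energy_update q i n
  rw [hn, Nat.add_sub_cancel]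
  rw [hn] at h
  push_cast at h ⊢
  refine add_right_cancel (b := (n : ℝ≥0) ^ 2) ?_
  linear_combination h

variable {lam : ℝ≥0} {T : ℝ} {A : Fin N → Finset (Fin N)}

theorem sum_arrival_energy_le (hN : 0 < N) (lam : ℝ≥0) (hT : 0 ≤ T) (hA : ∀ h, (A h).Nonempty)
    (q : Fin N → ℕ) :
    ∑ i, N * lam * joinProb T A q i * energy (Function.update q i (q i + 1)) ≤
      N * lam * (energy q + 1) + 2 * lam * ∑ i, (q i : ℝ≥0) :=
  calc ∑ i, N * lam * joinProb T A q i * energy (Function.update q i (q i + 1))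
      = N * lam * (energy q + 1) * ∑ i, joinProb T A q i +
          2 * lam * (N * ∑ i, joinProb T A q i * q i) := by
        simp_rw [energy_arrival, Finset.mul_sum, ← Finset.sum_add_distrib]
        exact Finset.sum_congr rfl fun i _ => by ring
    _ ≤ N * lam * (energy q + 1) + 2 * lam * ∑ i, (q i : ℝ≥0) := by
        rw [sum_joinProb hA hN, mul_one]
        gcongr
        exact sum_joinProb_mul_queue_le hA hT q

theorem sum_departure_energy_le (q : Fin N → ℕ) :
    ∑ i, (if 0 < q i then energy (Function.update q i (q i - 1)) else 0) +
        2 * ∑ i, (q i : ℝ≥0) ≤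
      (∑ i, if 0 < q i then 1 else 0) * energy q + N := by
  have queue : ∀ i, (if 0 < q i then energy (Function.update q i (q i - 1)) else 0) +
      2 * (q i : ℝ≥0) ≤ (if 0 < q i then 1 else 0) * energy q + 1 := fun i => by
    split_ifs with hi
    · rw [energy_departure hi, one_mul]
    · simp [Nat.eq_zero_of_not_pos hi]
  calc _ = ∑ i, ((if 0 < q i then energy (Function.update q i (q i - 1)) else 0) +
          2 * (q i : ℝ≥0)) := by rw [Finset.mul_sum, Finset.sum_add_distrib]
    _ ≤ ∑ i, ((if 0 < q i then 1 else 0) * energy q + 1) := Finset.sum_le_sum fun i _ => queue i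
    _ = (∑ i, if 0 < q i then 1 else 0) * energy q + N := by
        rw [Finset.sum_add_distrib, Finset.sum_mul]
        simp

theorem energy_drift (hN : 0 < N) (hlam1 : lam < 1) (hT : 0 ≤ T) (hA : ∀ h, (A h).Nonempty)
    (q : Fin N → ℕ) :
    ∑' q', ((chain N lam T A).rate q q' : ℝ≥0∞) * energy q' +
        ((2 * (1 - lam) * ∑ i, (q i : ℝ≥0) : ℝ≥0) : ℝ≥0∞) ≤
      (chain N lam T A).exitRate q * energy q + ((N * (1 + lam) : ℝ≥0) : ℝ≥0∞) := by
  rw [tsum_rate_mul, exitRate_eq hN lam T hA, ← ENNReal.coe_add, ← ENNReal.coe_mul,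
    ← ENNReal.coe_add, ENNReal.coe_le_coe]
  set arrivals := ∑ i, N * lam * joinProb T A q i * energy (Function.update q i (q i + 1))
  set departures := ∑ i, if 0 < q i then energy (Function.update q i (q i - 1)) else 0
  set total := ∑ i, (q i : ℝ≥0)
  have split : 2 * total = 2 * lam * total + 2 * (1 - lam) * total := by
    rw [← add_mul, ← mul_add, add_tsub_cancel_of_le hlam1.le, mul_one]
  have arrivals_le : arrivals ≤ N * lam * (energy q + 1) + 2 * lam * total :=
    sum_arrival_energy_le hN lam hT hA q
  have departures_le := sum_departure_energy_le q
  refine le_of_add_le_add_right (a := 2 * lam * total) ?_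
  linear_combination arrivals_le + departures_le - split

end Drift

section Mean

theorem natCast_mul_averageQueue (hN : 0 < N) (q : Fin N → ℕ) :
    N * averageQueue (some q) = ∑ i, (q i : ℝ≥0∞) :=
  ENNReal.mul_div_cancel (by exact_mod_cast hN.ne') (ENNReal.natCast_ne_top N)

theorem tsum_mul_averageQueue_le (hN : 0 < N) {lam : ℝ≥0} (hlam1 : lam < 1)
    {p : (Fin N → ℕ) → ℝ≥0∞}
    (h : ∑' q, p q * ((2 * (1 - lam) * ∑ i, (q i : ℝ≥0) : ℝ≥0) : ℝ≥0∞) ≤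
      ((N * (1 + lam) : ℝ≥0) : ℝ≥0∞)) :
    ∑' q, p q * averageQueue (some q) ≤ (((1 + lam) / (2 * (1 - lam)) : ℝ≥0) : ℝ≥0∞) := by
  have scale : 2 * (1 - lam) ≠ 0 := mul_ne_zero two_ne_zero (tsub_pos_of_lt hlam1).ne'
  have term : ∀ q : Fin N → ℕ, p q * ((2 * (1 - lam) * ∑ i, (q i : ℝ≥0) : ℝ≥0) : ℝ≥0∞) =
      N * (((2 * (1 - lam) : ℝ≥0) : ℝ≥0∞) * (p q * averageQueue (some q))) := fun q => by
    rw [ENNReal.coe_mul, ENNReal.ofNNReal_finsetSum]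
    simp only [ENNReal.coe_natCast, ← natCast_mul_averageQueue hN]
    ring
  simp only [term, ENNReal.tsum_mul_left, ENNReal.coe_mul N, ENNReal.coe_natCast] at h
  rw [ENNReal.mul_le_mul_iff_right (by exact_mod_cast hN.ne') (ENNReal.natCast_ne_top N)] at h
  rwa [ENNReal.coe_div scale, ENNReal.le_div_iff_mul_le (Or.inl (ENNReal.coe_ne_zero.2 scale))
    (Or.inl ENNReal.coe_ne_top), mul_comm]

theorem coe_one_add_div_lt_ofReal {lam : ℝ≥0} (hlam1 : lam < 1) :
    (((1 + lam) / (2 * (1 - lam)) : ℝ≥0) : ℝ≥0∞) < ENNReal.ofReal (1 / (1 - (lam : ℝ))) := by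
  have gap : 0 < 1 - (lam : ℝ) := sub_pos.2 hlam1
  rw [← ENNReal.ofReal_coe_nnreal, ENNReal.ofReal_lt_ofReal_iff (by positivity)]
  push_cast [NNReal.coe_sub hlam1.le]
  rw [div_lt_div_iff₀ (by positivity) gap]
  nlinarith

end Mean

end TTC

end

theorem theorem2 (N : ℕ) (hN : 0 < N) (lam : ℝ≥0) (hlam0 : 0 < lam) (hlam1 : lam < 1)
    (T : ℝ) (hT : 0 ≤ T) (A : Fin N → Finset (Fin N)) (hA : ∀ h, (A h).Nonempty) :
    (TTC.chain N lam T A).IsIrreducible ∧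
      (TTC.chain N lam T A).IsNonexplosive ∧
      (TTC.chain N lam T A).IsPositiveRecurrent ∧
      ∃ π : ProbabilityMeasure (Fin N → ℕ),
        (TTC.chain N lam T A).IsEquilibrium π ∧
        (∀ π', (TTC.chain N lam T A).IsEquilibrium π' → π' = π) ∧
        ∀ t : ℝ≥0,
          ∫⁻ ω, TTC.averageQueue ((TTC.chain N lam T A).state t ω)
              ∂((TTC.chain N lam T A).law (π : Measure (Fin N → ℕ))) <
            ENNReal.ofReal (1 / (1 - (lam : ℝ))) := by
  set Q := TTC.chain N lam T A
  have communicate := TTC.reaches hN hlam0 hT hA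
  have transProb_ne_zero : ∀ x y, Q.transProb 1 x y ≠ 0 := fun x y =>
    (Q.transProb_pos (communicate x y) one_pos).ne'
  have bounded : ∀ q, Q.exitRate q ≤ N * lam + N := TTC.exitRate_le hN lam T hA
  have nonexplosive := RateMatrix.isNonexplosive_of_exitRate_le bounded
  obtain ⟨p, mass, balanced, mean⟩ := RateMatrix.exists_isBalanced_of_drift bounded
    ENNReal.coe_ne_top 0 ENNReal.coe_ne_top (TTC.energy_drift hN hlam1 hT hA)
    (fun r => by
      simpa only [ENNReal.coe_le_coe] using
        finite_mul_sum_natCast_le (mul_pos two_pos (tsub_pos_of_lt hlam1)) r)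
    fun _ => ENNReal.coe_ne_top
  have finite_mass : ∑' q, p q ≠ ∞ := mass ▸ ENNReal.one_ne_top
  obtain ⟨π, rfl⟩ := exists_probabilityMeasure_singleton_eq mass
  have equilibrium : Q.IsEquilibrium π :=
    balanced.isEquilibrium (RateMatrix.tsum_mul_exitRate_ne_top bounded finite_mass)
  refine ⟨Q.isIrreducible_of_reflTransGen communicate, nonexplosive,
    balanced.isPositiveRecurrent nonexplosive (equilibrium.singleton_ne_zero transProb_ne_zero)
      finite_mass, π, equilibrium,
    fun π' h' => h'.eq nonexplosive transProb_ne_zero equilibrium, fun t => ?_⟩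
  rw [equilibrium.lintegral_state nonexplosive]
  exact (TTC.tsum_mul_averageQueue_le hN hlam1 mean).trans_lt (TTC.coe_one_add_div_lt_ofReal hlam1)
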